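/- Let $\mathfrak g=\mathfrak n_3(\mathbb R)\oplus\mathbb R$ be the real Lie algebra with basis $e_1,e_2,e_3,e_4$ whose only nonzero brackets of basis vectors are $[e_1,e_2]=-[e_2,e_1]=e_3$. An LR-structure on $\mathfrak g$ is a bilinear product $\cdot$ on $\mathfrak g$ with $$x\cdot(y\cdot z)=y\cdot(x\cdot z),\qquad (x\cdot y)\cdot z=(x\cdot z)\cdot y,\qquad [x,y]=x\cdot y-y\cdot x$$ for all $x,y,z\in\mathfrak g$; it is complete if every left multiplication $L(x)\colon y\mapsto x\cdot y$ is nilpotent. Two such structures are isomorphic if there is a linear bijection of $\mathfrak g$ carrying one product to the other. Consider the following products on $\mathfrak g$ (products of basis vectors that are not listed are $0$): - $A_1(\alpha)$, $\alpha\in\mathbb R$: $e_1e_2=\alpha e_3$, $e_2e_1=(\alpha-1)e_3$, $e_2e_2=e_1$, $e_4e_4=e_3$. - $A_2(\alpha)$, $\alpha\in\{0,1\}$: $e_1e_1=\alpha e_3$, $e_1e_2=e_4$, $e_2e_1=-e_3+e_4$, $e_2e_2=e_1$, $e_2e_4=\alpha e_3$, $e_4e_2=\alpha e_3$. - $A_3(\alpha,\beta)$,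 $\alpha\in\mathbb R$, $\beta\in\{0,1\}$: $e_1e_2=\alpha e_3$, $e_2e_1=(\alpha-1)e_3$, $e_2e_2=e_1$, $e_2e_4=\beta e_3$, $e_4e_2=\beta e_3$. - $A_4(\alpha)$, $\alpha\in\{0,1\}$: $e_1e_1=e_4$, $e_1e_4=e_3$, $e_2e_1=-e_3$, $e_2e_2=\alpha e_3$, $e_4e_1=e_3$. - $A_5(\alpha)$, $\alpha\in\{0,1\}$: $e_1e_4=e_3$, $e_2e_1=-e_3$, $e_2e_2=\alpha e_3$, $e_4e_1=e_3$. - $A_6(\alpha)$, $\alpha\in\mathbb R$: $e_1e_1=\alpha e_3$, $e_2e_1=-e_3$, $e_2e_2=e_3$, $e_4e_4=e_3$. - $A_7(\alpha)$, $\alpha\le\frac34$: $e_1e_1=\alpha e_3$, $e_2e_1=-e_3$, $e_2e_2=-e_3$, $e_4e_4=e_3$. - $A_8$: $e_1e_2=\frac12e_3$, $e_2e_1=-\frac12e_3$, $e_4e_4=e_3$. - $A_9(\alpha)$, $\alpha\ge\frac12$: $e_1e_1=e_4$, $e_1e_2=\alpha e_3$, $e_2e_1=(\alpha-1)e_3$,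 $e_2e_2=e_4$. - $A_{10}(\alpha)$, $\alpha\ge\frac12$: $e_1e_1=e_4$, $e_1e_2=\alpha e_3$, $e_2e_1=(\alpha-1)e_3$, $e_2e_2=-e_4$. - $A_{11}(\alpha)$, $\alpha\in\mathbb R$: $e_1e_1=e_4$, $e_1e_2=\alpha e_3$, $e_2e_1=(\alpha-1)e_3$. - $A_{12}$: $e_1e_1=e_4$, $e_2e_1=-e_3$, $e_2e_2=e_3$. - $A_{13}(\alpha)$, $\alpha\in\mathbb R$: $e_1e_1=e_3$, $e_2e_1=-e_3$, $e_2e_2=\alpha e_3$. - $A_{14}$: $e_1e_2=\frac12e_3$, $e_2e_1=-\frac12e_3$. - $A_{15}(\alpha)$, $\alpha\ge1$: $e_1e_1=e_4$, $e_2e_1=-e_3$, $e_2e_2=\alpha e_3-e_4$. Then the complete LR-structures on $\mathfrak g$ are classified by this list: 1. Every product in the list is a complete LR-structure on $\mathfrak g$. 2. Every complete LR-structure on $\mathfrak g$ is isomorphic to a member of the list; more precisely, it is isomorphic to exactly one member of the list obtained by restricting the range of $\alpha$ in $A_7(\alpha)$ to $\alpha\le-\frac14$. 3. Two members of the list (with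 the ranges given above) are isomorphic if and only if they belong to the same family with the same parameters, or they are $A_7(\alpha)$ and $A_6(-\alpha)$, in either order, for some $\alpha$ with $-\frac14<\alpha\le\frac34$. -/

import Mathlib

/-! ### LR-algebras -/

section LR

variable {k A B : Type*} [Field k] [AddCommGroup A] [Module k A] [AddCommGroup B] [Module k B]

/-- A bilinear product `μ` on `A`, written `x · y = μ x y`, makes `A` an LR-algebra:
`x · (y · z) = y · (x · z)` and `(x · y) · z = (x · z) · y`. -/
structure IsLRAlgebra (μ : A →ₗ[k] A →ₗ[k] A) : Prop where
  left_comm : ∀ x y z : A, μ x (μ y z) = μ y (μ x z)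
  right_comm : ∀ x y z : A, μ (μ x y) z = μ (μ x z) y

/-- The product is complete: every left multiplication `L(x) = μ x` is nilpotent. -/
def IsCompleteProduct (μ : A →ₗ[k] A →ₗ[k] A) : Prop :=
  ∀ x : A, IsNilpotent (μ x : Module.End k A)

/-- Isomorphism of the algebras `(A, μ)` and `(B, ν)`. -/
def AlgebraIso (μ : A →ₗ[k] A →ₗ[k] A) (ν : B →ₗ[k] B →ₗ[k] B) : Prop :=
  ∃ φ : A ≃ₗ[k] B, ∀ x y : A, φ (μ x y) = ν (φ x) (φ y)

/-- `μ` is an LR-structure on the Lie algebra `L`: an LR-algebra product on `L` whose commutator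
is the Lie bracket. -/
structure IsLRStructure (k L : Type*) [Field k] [LieRing L] [LieAlgebra k L]
    (μ : L →ₗ[k] L →ₗ[k] L) : Prop extends IsLRAlgebra μ where
  lie_eq : ∀ x y : L, ⁅x, y⁆ = μ x y - μ y x

/-- `μ` is a complete LR-structure on the Lie algebra `L`. -/
structure IsCompleteLRStructure (k L : Type*) [Field k] [LieRing L] [LieAlgebra k L]
    (μ : L →ₗ[k] L →ₗ[k] L) : Prop extends IsLRStructure k L μ where
  complete : IsCompleteProduct μ

end LR

/-! ### The Lie algebra `𝔫₃(ℝ) ⊕ ℝ` -/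

/-- The underlying space of the Heisenberg Lie algebra `𝔫₃(ℝ)`. -/
def HeisenbergLie : Type := Fin 3 → ℝ

namespace HeisenbergLie

noncomputable instance : AddCommGroup HeisenbergLie := inferInstanceAs (AddCommGroup (Fin 3 → ℝ))

noncomputable instance : Module ℝ HeisenbergLie := inferInstanceAs (Module ℝ (Fin 3 → ℝ))

@[ext] theorem ext {v w : HeisenbergLie} (h0 : v 0 = w 0) (h1 : v 1 = w 1) (h2 : v 2 = w 2) :
    v = w := by
  funext i
  fin_cases i
  · exact h0
  · exact h1
  · exact h2

@[simp] theorem add_apply (v w : HeisenbergLie) (i : Fin 3) : (v + w) i = v i + w i := rfl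

@[simp] theorem zero_apply (i : Fin 3) : (0 : HeisenbergLie) i = 0 := rfl

@[simp] theorem smul_apply (c : ℝ) (v : HeisenbergLie) (i : Fin 3) : (c • v) i = c * v i := rfl

/-- The bracket with `[e₁, e₂] = e₃` and `e₃` central. -/
noncomputable instance : Bracket HeisenbergLie HeisenbergLie where
  bracket v w := (![0, 0, v 0 * w 1 - v 1 * w 0] : Fin 3 → ℝ)

@[simp] theorem bracket_zero (v w : HeisenbergLie) : ⁅v, w⁆ 0 = 0 := rfl

@[simp] theorem bracket_one (v w : HeisenbergLie) : ⁅v, w⁆ 1 = 0 := rfl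

@[simp] theorem bracket_two (v w : HeisenbergLie) : ⁅v, w⁆ 2 = v 0 * w 1 - v 1 * w 0 := rfl

noncomputable instance : LieRing HeisenbergLie where
  add_lie u v w := by
    ext <;> simp
    ring
  lie_add u v w := by
    ext <;> simp
    ring
  lie_self u := by
    ext <;> simp
    ring
  leibniz_lie u v w := by
    ext <;> simp

noncomputable instance : LieAlgebra ℝ HeisenbergLie where
  lie_smul c v w := by
    ext <;> simp
    ring

end HeisenbergLie

/-- The Lie algebra `𝔫₃(ℝ) ⊕ ℝ`, the direct sum of `𝔫₃(ℝ)` and the one-dimensional abelian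
Lie algebra `ℝ`. -/
abbrev N3R : Type := HeisenbergLie × ℝ

/-- The bracket of the direct sum. -/
noncomputable instance : Bracket N3R N3R where
  bracket x y := (⁅x.1, y.1⁆, 0)

namespace N3R

theorem bracket_def (x y : N3R) : ⁅x, y⁆ = (⁅x.1, y.1⁆, 0) := rfl

end N3R

noncomputable instance : LieRing N3R where
  add_lie u v w := by simp [N3R.bracket_def]
  lie_add u v w := by simp [N3R.bracket_def]
  lie_self u := by simp [N3R.bracket_def]
  leibniz_lie u v w := by simp [N3R.bracket_def]

noncomputable instance : LieAlgebra ℝ N3R where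
  lie_smul c u v := by simp [N3R.bracket_def]

namespace N3R

/-- Coordinates with respect to `(e₁, e₂, e₃, e₄)`. -/
noncomputable def coords : N3R ≃ₗ[ℝ] (Fin 4 → ℝ) where
  toFun p := ![p.1 0, p.1 1, p.1 2, p.2]
  invFun c := ((![c 0, c 1, c 2] : Fin 3 → ℝ), c 3)
  map_add' p q := by
    ext i
    fin_cases i <;> rfl
  map_smul' r p := by
    ext i
    fin_cases i <;> rfl
  left_inv p := by
    refine Prod.ext ?_ rfl
    ext <;> rfl
  right_inv c := by
    ext i
    fin_cases i <;> rfl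

/-- The standard basis: `(basis 0, basis 1, basis 2)` is the basis `(e₁, e₂, e₃)` of `𝔫₃(ℝ)`,
and `basis 3` is the vector `e₄` spanning the summand `ℝ`. -/
noncomputable def basis : Module.Basis (Fin 4) ℝ N3R := Module.Basis.ofEquivFun coords

/-- The basis vector `e₁`. -/
noncomputable abbrev e₁ : N3R := basis 0

/-- The basis vector `e₂`. -/
noncomputable abbrev e₂ : N3R := basis 1

/-- The basis vector `e₃`. -/
noncomputable abbrev e₃ : N3R := basis 2

/-- The basis vector `e₄`. -/
noncomputable abbrev e₄ : N3R := basis 3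

/-- The bilinear product with `eᵢ · eⱼ = T i j`. -/
noncomputable def ofTable (T : Matrix (Fin 4) (Fin 4) N3R) : N3R →ₗ[ℝ] N3R →ₗ[ℝ] N3R :=
  basis.constr ℝ fun i => basis.constr ℝ (T i)

/-- The index set of the fifteen families, before the parameters are restricted. -/
inductive Family : Type
  | A1 (α : ℝ)
  | A2 (α : ℝ)
  | A3 (α β : ℝ)
  | A4 (α : ℝ)
  | A5 (α : ℝ)
  | A6 (α : ℝ)
  | A7 (α : ℝ)
  | A8
  | A9 (α : ℝ)
  | A10 (α : ℝ)
  | A11 (α : ℝ)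
  | A12
  | A13 (α : ℝ)
  | A14
  | A15 (α : ℝ)

namespace Family

/-- The parameter ranges. -/
def InRange : Family → Prop
  | A1 _ => True
  | A2 α => α = 0 ∨ α = 1
  | A3 _ β => β = 0 ∨ β = 1
  | A4 α => α = 0 ∨ α = 1
  | A5 α => α = 0 ∨ α = 1
  | A6 _ => True
  | A7 α => α ≤ 3 / 4
  | A8 => True
  | A9 α => 1 / 2 ≤ α
  | A10 α => 1 / 2 ≤ α
  | A11 _ => True
  | A12 => True
  | A13 _ => True
  | A14 => True
  | A15 α => 1 ≤ α

/-- The multiplication tables: row `i`, column `j` is the product `eᵢ · eⱼ`. -/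
noncomputable def table : Family → Matrix (Fin 4) (Fin 4) N3R
  | A1 α => !![
      0, α • e₃, 0, 0;
      (α - 1) • e₃, e₁, 0, 0;
      0, 0, 0, 0;
      0, 0, 0, e₃]
  | A2 α => !![
      α • e₃, e₄, 0, 0;
      -e₃ + e₄, e₁, 0, α • e₃;
      0, 0, 0, 0;
      0, α • e₃, 0, 0]
  | A3 α β => !![
      0, α • e₃, 0, 0;
      (α - 1) • e₃, e₁, 0, β • e₃;
      0, 0, 0, 0;
      0, β • e₃, 0, 0]
  | A4 α => !![
      e₄, 0, 0, e₃;
      -e₃, α • e₃, 0, 0;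
      0, 0, 0, 0;
      e₃, 0, 0, 0]
  | A5 α => !![
      0, 0, 0, e₃;
      -e₃, α • e₃, 0, 0;
      0, 0, 0, 0;
      e₃, 0, 0, 0]
  | A6 α => !![
      α • e₃, 0, 0, 0;
      -e₃, e₃, 0, 0;
      0, 0, 0, 0;
      0, 0, 0, e₃]
  | A7 α => !![
      α • e₃, 0, 0, 0;
      -e₃, -e₃, 0, 0;
      0, 0, 0, 0;
      0, 0, 0, e₃]
  | A8 => !![
      0, (1 / 2 : ℝ) • e₃, 0, 0;
      -(1 / 2 : ℝ) • e₃, 0, 0, 0;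
      0, 0, 0, 0;
      0, 0, 0, e₃]
  | A9 α => !![
      e₄, α • e₃, 0, 0;
      (α - 1) • e₃, e₄, 0, 0;
      0, 0, 0, 0;
      0, 0, 0, 0]
  | A10 α => !![
      e₄, α • e₃, 0, 0;
      (α - 1) • e₃, -e₄, 0, 0;
      0, 0, 0, 0;
      0, 0, 0, 0]
  | A11 α => !![
      e₄, α • e₃, 0, 0;
      (α - 1) • e₃, 0, 0, 0;
      0, 0, 0, 0;
      0, 0, 0, 0]
  | A12 => !![
      e₄, 0, 0, 0;
      -e₃, e₃, 0, 0;
      0, 0, 0, 0;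
      0, 0, 0, 0]
  | A13 α => !![
      e₃, 0, 0, 0;
      -e₃, α • e₃, 0, 0;
      0, 0, 0, 0;
      0, 0, 0, 0]
  | A14 => !![
      0, (1 / 2 : ℝ) • e₃, 0, 0;
      -(1 / 2 : ℝ) • e₃, 0, 0, 0;
      0, 0, 0, 0;
      0, 0, 0, 0]
  | A15 α => !![
      e₄, 0, 0, 0;
      -e₃, α • e₃ - e₄, 0, 0;
      0, 0, 0, 0;
      0, 0, 0, 0]

/-- The product on `𝔫₃(ℝ) ⊕ ℝ` of a member of the list. -/
noncomputable def product (F : Family) : N3R →ₗ[ℝ] N3R →ₗ[ℝ] N3R := ofTable F.table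

end Family

end N3R

/-! Left multiplications of an LR-structure are derivations of the Lie algebra. A derivation sends
`e₃ = ⁅e₁, e₂⁆` to a multiple of itself by a trace, and nilpotency makes this trace zero; so `e₃`
annihilates everything, the centre is preserved, and `e₄` is multiplied into `ℝ e₃`. Modulo the
centre there remains a commutative product on a plane whose left multiplications are nilpotent. It
is either zero or has the form `f₂ · f₂ = f₁` with all other products zero (`exists_coeffs`). Hence
every structure is encoded by a constant `c ∈ {0, 1}`, a quadratic form `(s, l)` on the span of `e₁,
e₂, e₄`, and a quadratic form `b` on the span of `e₁, e₂`, subject to the few equations of `IsLR`.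

An isomorphism respects the brackets, so it acts on this data by a plane change of basis, shears
along the centre and a scaling of `e₄`. In particular `e₃` is scaled by the determinant of the plane
part (`IsIntertwiner`). Classification is then elementary reduction of forms. The essential case `c
= l = 0` concerns pairs of binary forms in which `b` may be rescaled, `s` is taken modulo `b`, and
`s` is scaled by the determinant; the signature of `b` organises the normal forms (`isClassified`).

Distinct members are separated by the vanishing of `c`, `l` and `b`, by the sign of `det b`, by `det
s` when `b = 0`, and by the discriminant of `det (λ s + μ b)` relative to `det b`. The one overlap,
`A₇(α)` with `A₆(-α)`, occurs exactly when the `s`-form of `A₇(α)` is indefinite. -/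

namespace N3R

/-! ### Coordinates and structure constants -/

/-- The element with coordinates `(a, b, c, d)`. -/
noncomputable def vec (a b c d : ℝ) : N3R := ((![a, b, c] : Fin 3 → ℝ), d)

@[simp] theorem vec_zero (a b c d : ℝ) : (vec a b c d).1 0 = a := rfl
@[simp] theorem vec_one (a b c d : ℝ) : (vec a b c d).1 1 = b := rfl
@[simp] theorem vec_two (a b c d : ℝ) : (vec a b c d).1 2 = c := rfl
@[simp] theorem vec_three (a b c d : ℝ) : (vec a b c d).2 = d := rfl

theorem ext_coords {x y : N3R} (h0 : x.1 0 = y.1 0) (h1 : x.1 1 = y.1 1) (h2 : x.1 2 = y.1 2)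
    (h3 : x.2 = y.2) : x = y :=
  Prod.ext (HeisenbergLie.ext h0 h1 h2) h3

@[simp] theorem vec_eq_zero : vec 0 0 0 0 = 0 := ext_coords rfl rfl rfl rfl

@[simp] theorem neg_heis_apply (x : HeisenbergLie) (i : Fin 3) : (-x) i = -x i := rfl
@[simp] theorem sub_heis_apply (x y : HeisenbergLie) (i : Fin 3) : (x - y) i = x i - y i := rfl

theorem lie_eq_vec (x y : N3R) : ⁅x, y⁆ = vec 0 0 (x.1 0 * y.1 1 - x.1 1 * y.1 0) 0 :=
  ext_coords rfl rfl rfl rfl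

theorem basis_apply (i : Fin 4) : basis i = coords.symm (Pi.single i 1) := by
  simp [basis, Module.Basis.coe_ofEquivFun]

theorem e₁_eq : e₁ = vec 1 0 0 0 := by
  rw [e₁, basis_apply]
  exact ext_coords rfl rfl rfl rfl

theorem e₂_eq : e₂ = vec 0 1 0 0 := by
  rw [e₂, basis_apply]
  exact ext_coords rfl rfl rfl rfl

theorem e₃_eq : e₃ = vec 0 0 1 0 := by
  rw [e₃, basis_apply]
  exact ext_coords rfl rfl rfl rfl

theorem e₄_eq : e₄ = vec 0 0 0 1 := by
  rw [e₄, basis_apply]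
  exact ext_coords rfl rfl rfl rfl

theorem ofTable_apply (T : Matrix (Fin 4) (Fin 4) N3R) (x y : N3R) :
    ofTable T x y = ∑ i, ∑ j, (coords x i * coords y j) • T i j := by
  have h (z : N3R) (i : Fin 4) : basis.repr z i = coords z i := by
    rw [← Module.Basis.equivFun_apply, basis, Module.Basis.equivFun_ofEquivFun]
  simp [ofTable, Module.Basis.constr_apply_fintype, h, Finset.smul_sum, mul_smul,
    LinearMap.sum_apply]

/-- Structure constants of a product on `𝔫₃(ℝ) ⊕ ℝ` whose commutator is the bracket, for which
`e₃` annihilates everything, `e₄` is multiplied into `ℝ e₃`, and whose reduction modulo the centre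
is `e₂ · e₂ = c e₁`. The forms `(sᵢⱼ, lᵢ)` and `(bᵢⱼ)` are the symmetric parts of the coordinates
of the product along `e₃` and `e₄`. -/
structure Coeffs : Type where
  c : ℝ
  s11 : ℝ
  s12 : ℝ
  s22 : ℝ
  l1 : ℝ
  l2 : ℝ
  l4 : ℝ
  b11 : ℝ
  b12 : ℝ
  b22 : ℝ

namespace Coeffs

/-- The value of the product with given structure constants. -/
noncomputable def mul (A : Coeffs) (x y : N3R) : N3R :=
  vec (A.c * (x.1 1 * y.1 1)) 0
    (A.s11 * (x.1 0 * y.1 0) + A.s12 * (x.1 0 * y.1 1 + x.1 1 * y.1 0) + A.s22 * (x.1 1 * y.1 1)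
      + A.l1 * (x.1 0 * y.2 + x.2 * y.1 0) + A.l2 * (x.1 1 * y.2 + x.2 * y.1 1)
      + A.l4 * (x.2 * y.2) + (x.1 0 * y.1 1 - x.1 1 * y.1 0) / 2)
    (A.b11 * (x.1 0 * y.1 0) + A.b12 * (x.1 0 * y.1 1 + x.1 1 * y.1 0) + A.b22 * (x.1 1 * y.1 1))

/-- The bilinear product with given structure constants. -/
noncomputable def toProduct (A : Coeffs) : N3R →ₗ[ℝ] N3R →ₗ[ℝ] N3R :=
  LinearMap.mk₂ ℝ A.mul
    (fun _ _ _ => by apply ext_coords <;> simp [mul] <;> ring)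
    (fun _ _ _ => by apply ext_coords <;> simp [mul] <;> ring)
    (fun _ _ _ => by apply ext_coords <;> simp [mul] <;> ring)
    (fun _ _ _ => by apply ext_coords <;> simp [mul] <;> ring)

theorem toProduct_apply (A : Coeffs) (x y : N3R) : A.toProduct x y = A.mul x y := rfl

theorem lie_eq (A : Coeffs) (x y : N3R) : ⁅x, y⁆ = A.toProduct x y - A.toProduct y x := by
  rw [lie_eq_vec, toProduct_apply, toProduct_apply]
  apply ext_coords <;> simp [mul] <;> ring

theorem isCompleteProduct (A : Coeffs) : IsCompleteProduct A.toProduct := by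
  intro x
  -- Each left multiplication moves one step down the flag with successive spans of `e₁, e₃, e₄`,
  -- then `e₃, e₄`, then `e₃`, then `0`.
  refine ⟨4, LinearMap.ext fun y => ?_⟩
  simp only [pow_succ, pow_zero, Module.End.mul_apply, Module.End.one_apply, toProduct_apply]
  apply ext_coords <;> simp [mul]

/-- The equations that the structure constants of an LR-structure satisfy. -/
def IsLR (A : Coeffs) : Prop :=
  A.c * A.l1 + A.b22 * A.l4 = 0 ∧ A.b11 * A.l4 = 0 ∧ A.b12 * A.l4 = 0 ∧ A.c * A.b11 = 0 ∧
  A.c * A.s11 + A.b22 * A.l1 = A.b12 * A.l2 ∧ A.b11 * A.l2 = A.b12 * A.l1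

theorem isLRAlgebra_of_isLR {A : Coeffs} (h : A.IsLR) : IsLRAlgebra A.toProduct := by
  obtain ⟨h1, h2, h3, h4, h5, h6⟩ := h
  constructor <;> intro x y z <;> simp only [toProduct_apply] <;> apply ext_coords <;>
    simp [mul] <;> grind

/-- Left commutativity on a few basis triples already yields all six equations; right commutativity
imposes nothing further. -/
theorem isLR_of_isLRAlgebra {A : Coeffs} (h : IsLRAlgebra A.toProduct) : A.IsLR := by
  have k1 := h.left_comm e₄ e₂ e₂
  have k2 := h.left_comm e₄ e₁ e₁
  have k3 := h.left_comm e₄ e₁ e₂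
  have k5 := h.left_comm e₁ e₂ e₂
  have k6 := h.left_comm e₁ e₂ e₁
  simp only [toProduct_apply, e₁_eq, e₂_eq, e₄_eq] at k1 k2 k3 k5 k6
  have t1 := congrArg (fun x : N3R => x.1 2) k1
  have t2 := congrArg (fun x : N3R => x.1 2) k2
  have t3 := congrArg (fun x : N3R => x.1 2) k3
  have t4 := congrArg (fun x : N3R => x.2) k5
  have t5 := congrArg (fun x : N3R => x.1 2) k5
  have t6 := congrArg (fun x : N3R => x.1 2) k6
  simp [mul] at t1 t2 t3 t4 t5 t6
  refine ⟨?_, ?_, ?_, ?_, ?_, ?_⟩ <;> grind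

end Coeffs

namespace Family

/-- The structure constants of the members of the list. -/
noncomputable def coeffs : Family → Coeffs
  | A1 α => ⟨1, 0, α - 1 / 2, 0, 0, 0, 1, 0, 0, 0⟩
  | A2 α => ⟨1, α, -1 / 2, 0, 0, α, 0, 0, 1, 0⟩
  | A3 α β => ⟨1, 0, α - 1 / 2, 0, 0, β, 0, 0, 0, 0⟩
  | A4 α => ⟨0, 0, -1 / 2, α, 1, 0, 0, 1, 0, 0⟩
  | A5 α => ⟨0, 0, -1 / 2, α, 1, 0, 0, 0, 0, 0⟩
  | A6 α => ⟨0, α, -1 / 2, 1, 0, 0, 1, 0, 0, 0⟩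
  | A7 α => ⟨0, α, -1 / 2, -1, 0, 0, 1, 0, 0, 0⟩
  | A8 => ⟨0, 0, 0, 0, 0, 0, 1, 0, 0, 0⟩
  | A9 α => ⟨0, 0, α - 1 / 2, 0, 0, 0, 0, 1, 0, 1⟩
  | A10 α => ⟨0, 0, α - 1 / 2, 0, 0, 0, 0, 1, 0, -1⟩
  | A11 α => ⟨0, 0, α - 1 / 2, 0, 0, 0, 0, 1, 0, 0⟩
  | A12 => ⟨0, 0, -1 / 2, 1, 0, 0, 0, 1, 0, 0⟩
  | A13 α => ⟨0, 1, -1 / 2, α, 0, 0, 0, 0, 0, 0⟩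
  | A14 => ⟨0, 0, 0, 0, 0, 0, 0, 0, 0, 0⟩
  | A15 α => ⟨0, 0, -1 / 2, α, 0, 0, 0, 1, 0, -1⟩

theorem product_eq (F : Family) : F.product = F.coeffs.toProduct := by
  refine LinearMap.ext₂ fun x y => ?_
  have h0 (z : N3R) : coords z 0 = z.1 0 := rfl
  have h1 (z : N3R) : coords z 1 = z.1 1 := rfl
  have h2 (z : N3R) : coords z 2 = z.1 2 := rfl
  have h3 (z : N3R) : coords z 3 = z.2 := rfl
  rw [product, ofTable_apply, Coeffs.toProduct_apply]
  simp only [Fin.sum_univ_four, h0, h1, h2, h3]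
  cases F <;>
  · simp only [table, e₁_eq, e₃_eq, e₄_eq]
    apply ext_coords <;> simp [coeffs, Coeffs.mul] <;> ring

theorem isLR (F : Family) : F.coeffs.IsLR := by
  cases F <;> simp [coeffs, Coeffs.IsLR]

theorem isCompleteLRStructure (F : Family) : IsCompleteLRStructure ℝ N3R F.product := by
  rw [product_eq]
  exact ⟨⟨Coeffs.isLRAlgebra_of_isLR F.isLR, F.coeffs.lie_eq⟩, F.coeffs.isCompleteProduct⟩

end Family
end N3R

/-! ### Isomorphisms of algebras and nilpotent endomorphisms -/

section AlgebraIso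

variable {k A B C : Type*} [Field k] [AddCommGroup A] [Module k A] [AddCommGroup B] [Module k B]
  [AddCommGroup C] [Module k C]

theorem AlgebraIso.refl (μ : A →ₗ[k] A →ₗ[k] A) : AlgebraIso μ μ :=
  ⟨LinearEquiv.refl k A, fun _ _ => rfl⟩

theorem AlgebraIso.symm {μ : A →ₗ[k] A →ₗ[k] A} {ν : B →ₗ[k] B →ₗ[k] B}
    (h : AlgebraIso μ ν) : AlgebraIso ν μ := by
  obtain ⟨φ, hφ⟩ := h
  exact ⟨φ.symm, fun x y => by rw [LinearEquiv.symm_apply_eq, hφ]; simp⟩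

theorem AlgebraIso.trans {μ : A →ₗ[k] A →ₗ[k] A} {ν : B →ₗ[k] B →ₗ[k] B}
    {ρ : C →ₗ[k] C →ₗ[k] C} (h : AlgebraIso μ ν) (h' : AlgebraIso ν ρ) : AlgebraIso μ ρ := by
  obtain ⟨φ, hφ⟩ := h
  obtain ⟨ψ, hψ⟩ := h'
  exact ⟨φ.trans ψ, fun x y => by simp [hφ, hψ]⟩

theorem AlgebraIso.isLRAlgebra {μ : A →ₗ[k] A →ₗ[k] A} {ν : B →ₗ[k] B →ₗ[k] B}
    (h : AlgebraIso μ ν) (hμ : IsLRAlgebra μ) : IsLRAlgebra ν := by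
  obtain ⟨φ, hφ⟩ := h
  have hs (x y : B) : ν x y = φ (μ (φ.symm x) (φ.symm y)) := by simp [hφ]
  constructor
  · intro x y z
    simp only [hs, LinearEquiv.symm_apply_apply]
    rw [hμ.left_comm]
  · intro x y z
    simp only [hs, LinearEquiv.symm_apply_apply]
    rw [hμ.right_comm]

end AlgebraIso

/-- A nilpotent endomorphism preserving a submodule `N` has no nonzero eigenvalue modulo `N`. -/
theorem eq_zero_of_isNilpotent_of_sub_smul_mem {k V : Type*} [Field k] [AddCommGroup V]
    [Module k V] {f : Module.End k V} (hf : IsNilpotent f) {N : Submodule k V}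
    (hN : ∀ v ∈ N, f v ∈ N) {t : k} {w : V} (hw : w ∉ N) (h : f w - t • w ∈ N) : t = 0 := by
  obtain ⟨n, hn⟩ := hf
  have key (m : ℕ) : (f ^ m) w - t ^ m • w ∈ N := by
    induction m with
    | zero => simp
    | succ m ih =>
      have h1 := N.add_mem (hN _ ih) (N.smul_mem (t ^ m) h)
      have h2 : (f ^ (m + 1)) w - t ^ (m + 1) • w
          = f ((f ^ m) w - t ^ m • w) + t ^ m • (f w - t • w) := by
        rw [pow_succ', Module.End.mul_apply, map_sub, map_smul, smul_sub, smul_smul, pow_succ]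
        abel
      rwa [h2]
  have h3 := key n
  rw [hn, LinearMap.zero_apply, zero_sub, N.neg_mem_iff] at h3
  by_contra ht
  exact hw ((N.smul_mem_iff (pow_ne_zero n ht)).1 h3)

/-! ### Isomorphisms in terms of structure constants -/

namespace N3R

instance : Module.Finite ℝ N3R := Module.Finite.of_basis basis

theorem algebraIso_of_injective {μ ν : N3R →ₗ[ℝ] N3R →ₗ[ℝ] N3R} (φ : N3R →ₗ[ℝ] N3R)
    (hφ : ∀ x, φ x = 0 → x = 0) (h : ∀ x y, φ (μ x y) = ν (φ x) (φ y)) : AlgebraIso μ ν :=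
  ⟨LinearEquiv.ofInjectiveEndo φ ((injective_iff_map_eq_zero φ).2 hφ), fun x y => by
    simpa using h x y⟩

theorem eq_sum (x : N3R) : x = x.1 0 • e₁ + x.1 1 • e₂ + x.1 2 • e₃ + x.2 • e₄ := by
  rw [e₁_eq, e₂_eq, e₃_eq, e₄_eq]
  apply ext_coords <;> simp

namespace Coeffs

/-- The equations expressing that the linear map with
`e₁ ↦ p₁₁ e₁ + p₂₁ e₂ + u e₃ + v₁ e₄`, `e₂ ↦ p₁₂ e₁ + p₂₂ e₂ + v₂ e₄`,
`e₃ ↦ (p₁₁ p₂₂ - p₂₁ p₁₂) e₃`, `e₄ ↦ d e₃ + κ e₄` is an isomorphism between the products with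
structure constants `A` and `B`. -/
structure IsIntertwiner (A B : Coeffs) (p11 p12 p21 p22 u v1 v2 κ d : ℝ) : Prop where
  det_ne : p11 * p22 - p21 * p12 ≠ 0
  κ_ne : κ ≠ 0
  c1 : A.c * p11 = B.c * p22 ^ 2
  c2 : A.c * p21 = 0
  c3 : B.c * p21 = 0
  b11 : κ * A.b11 = B.b11 * p11 ^ 2 + 2 * B.b12 * p11 * p21 + B.b22 * p21 ^ 2
  b12 : κ * A.b12 = B.b11 * p11 * p12 + B.b12 * (p11 * p22 + p21 * p12) + B.b22 * p21 * p22
  b22 : v1 * A.c + κ * A.b22 = B.b11 * p12 ^ 2 + 2 * B.b12 * p12 * p22 + B.b22 * p22 ^ 2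
  s11 : (p11 * p22 - p21 * p12) * A.s11 + d * A.b11 = B.s11 * p11 ^ 2 + 2 * B.s12 * p11 * p21
    + B.s22 * p21 ^ 2 + 2 * B.l1 * p11 * v1 + 2 * B.l2 * p21 * v1 + B.l4 * v1 ^ 2
  s12 : (p11 * p22 - p21 * p12) * A.s12 + d * A.b12 = B.s11 * p11 * p12
    + B.s12 * (p11 * p22 + p21 * p12) + B.s22 * p21 * p22 + B.l1 * (p11 * v2 + v1 * p12)
    + B.l2 * (p21 * v2 + v1 * p22) + B.l4 * v1 * v2
  s22 : u * A.c + (p11 * p22 - p21 * p12) * A.s22 + d * A.b22 = B.s11 * p12 ^ 2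
    + 2 * B.s12 * p12 * p22 + B.s22 * p22 ^ 2 + 2 * B.l1 * p12 * v2 + 2 * B.l2 * p22 * v2
    + B.l4 * v2 ^ 2
  l1 : (p11 * p22 - p21 * p12) * A.l1 = κ * (B.l1 * p11 + B.l2 * p21 + B.l4 * v1)
  l2 : (p11 * p22 - p21 * p12) * A.l2 = κ * (B.l1 * p12 + B.l2 * p22 + B.l4 * v2)
  l4 : (p11 * p22 - p21 * p12) * A.l4 = κ ^ 2 * B.l4

theorem IsIntertwiner.algebraIso {A B : Coeffs} {p11 p12 p21 p22 u v1 v2 κ d : ℝ}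
    (h : IsIntertwiner A B p11 p12 p21 p22 u v1 v2 κ d) :
    AlgebraIso A.toProduct B.toProduct := by
  let φ : N3R →ₗ[ℝ] N3R :=
    { toFun := fun x => vec (p11 * x.1 0 + p12 * x.1 1) (p21 * x.1 0 + p22 * x.1 1)
        (u * x.1 0 + (p11 * p22 - p21 * p12) * x.1 2 + d * x.2) (v1 * x.1 0 + v2 * x.1 1 + κ * x.2)
      map_add' := fun x y => by apply ext_coords <;> simp <;> ring
      map_smul' := fun r x => by apply ext_coords <;> simp <;> ring }
  have hφ (x : N3R) : φ x = vec (p11 * x.1 0 + p12 * x.1 1) (p21 * x.1 0 + p22 * x.1 1)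
      (u * x.1 0 + (p11 * p22 - p21 * p12) * x.1 2 + d * x.2)
      (v1 * x.1 0 + v2 * x.1 1 + κ * x.2) := rfl
  have hD := h.det_ne
  have hκ := h.κ_ne
  refine algebraIso_of_injective φ (fun x hx => ?_) (fun x y => ?_)
  · have t0 : (φ x).1 0 = 0 := by rw [hx]; rfl
    have t1 : (φ x).1 1 = 0 := by rw [hx]; rfl
    have t2 : (φ x).1 2 = 0 := by rw [hx]; rfl
    have t3 : (φ x).2 = 0 := by rw [hx]; rfl
    simp only [hφ, vec_zero, vec_one, vec_two, vec_three] at t0 t1 t2 t3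
    have x0 : x.1 0 = 0 := by
      apply (mul_eq_zero.1 (_ : (p11 * p22 - p21 * p12) * x.1 0 = 0)).resolve_left hD
      linear_combination p22 * t0 - p12 * t1
    have x1 : x.1 1 = 0 := by
      apply (mul_eq_zero.1 (_ : (p11 * p22 - p21 * p12) * x.1 1 = 0)).resolve_left hD
      linear_combination p11 * t1 - p21 * t0
    have x3 : x.2 = 0 := by simpa [x0, x1, hκ] using t3
    have x2 : x.1 2 = 0 := by simpa [x0, x3, hD] using t2
    exact ext_coords x0 x1 x2 x3
  · rw [toProduct_apply, toProduct_apply, hφ, hφ, hφ]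
    apply ext_coords
    · simp only [mul, vec_zero, vec_one, vec_two, vec_three]
      linear_combination x.1 1 * y.1 1 * h.c1
        - (p21 * x.1 0 * y.1 0 + p22 * x.1 0 * y.1 1 + p22 * x.1 1 * y.1 0) * h.c3
    · simp only [mul, vec_zero, vec_one, vec_two, vec_three]
      linear_combination x.1 1 * y.1 1 * h.c2
    · simp only [mul, vec_zero, vec_one, vec_two, vec_three]
      linear_combination x.1 0 * y.1 0 * h.s11 + (x.1 0 * y.1 1 + x.1 1 * y.1 0) * h.s12
        + x.1 1 * y.1 1 * h.s22 + (x.1 0 * y.2 + x.2 * y.1 0) * h.l1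
        + (x.1 1 * y.2 + x.2 * y.1 1) * h.l2 + x.2 * y.2 * h.l4
    · simp only [mul, vec_zero, vec_one, vec_two, vec_three]
      linear_combination x.1 0 * y.1 0 * h.b11 + (x.1 0 * y.1 1 + x.1 1 * y.1 0) * h.b12
        + x.1 1 * y.1 1 * h.b22

/-- An isomorphism preserves commutators, hence the centre and the derived algebra. The
`e₃`-coordinate of the image of `e₂` is not recorded: products have no `e₂`-coordinate and `e₃`
annihilates everything, so it enters no equation. -/
theorem exists_isIntertwiner {A B : Coeffs} (h : AlgebraIso A.toProduct B.toProduct) :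
    ∃ p11 p12 p21 p22 u v1 v2 κ d : ℝ, IsIntertwiner A B p11 p12 p21 p22 u v1 v2 κ d := by
  obtain ⟨φ, hφ⟩ := h
  have hlie (x y : N3R) : φ ⁅x, y⁆ = ⁅φ x, φ y⁆ := by rw [A.lie_eq, B.lie_eq, map_sub, hφ, hφ]
  have h3 : φ e₃ = vec 0 0 ((φ e₁).1 0 * (φ e₂).1 1 - (φ e₁).1 1 * (φ e₂).1 0) 0 := by
    rw [← lie_eq_vec, ← hlie, lie_eq_vec, e₁_eq, e₂_eq, e₃_eq]
    simp
  have hcen (z : N3R) : ⁅φ e₄, z⁆ = 0 := by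
    have := hlie e₄ (φ.symm z)
    rw [φ.apply_symm_apply] at this
    rw [← this, lie_eq_vec, e₄_eq]
    simp only [vec_zero, vec_one, zero_mul, sub_zero]
    exact φ.map_eq_zero_iff.2 vec_eq_zero
  have h40 : (φ e₄).1 0 = 0 := by
    simpa [lie_eq_vec, e₂_eq] using congrArg (fun x : N3R => x.1 2) (hcen e₂)
  have h41 : (φ e₄).1 1 = 0 := by
    simpa [lie_eq_vec, e₁_eq] using congrArg (fun x : N3R => x.1 2) (hcen e₁)
  have hD : (φ e₁).1 0 * (φ e₂).1 1 - (φ e₁).1 1 * (φ e₂).1 0 ≠ 0 := by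
    intro h0
    rw [h0] at h3
    have : e₃ = 0 := φ.map_eq_zero_iff.1 (h3.trans vec_eq_zero)
    exact basis.ne_zero 2 this
  have hκ : (φ e₄).2 ≠ 0 := by
    intro h0
    have h1 : φ (((φ e₁).1 0 * (φ e₂).1 1 - (φ e₁).1 1 * (φ e₂).1 0) • e₄ - (φ e₄).1 2 • e₃) = 0 := by
      rw [map_sub, map_smul, map_smul, h3]
      apply ext_coords <;> simp [h40, h41, h0]
      ring
    have h2 := congrArg (fun x : N3R => x.2) (φ.map_eq_zero_iff.1 h1)
    simp [e₃_eq, e₄_eq, hD] at h2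
  have hx (x : N3R) : φ x = x.1 0 • φ e₁ + x.1 1 • φ e₂ + x.1 2 • φ e₃ + x.2 • φ e₄ := by
    conv_lhs => rw [eq_sum x]
    simp only [map_add, map_smul]
  generalize φ e₁ = a at *
  generalize φ e₂ = b at *
  generalize φ e₄ = w at *
  have hc (x : N3R) : φ x = vec (x.1 0 * a.1 0 + x.1 1 * b.1 0) (x.1 0 * a.1 1 + x.1 1 * b.1 1)
      (x.1 0 * a.1 2 + x.1 1 * b.1 2 + x.1 2 * (a.1 0 * b.1 1 - a.1 1 * b.1 0) + x.2 * w.1 2)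
      (x.1 0 * a.2 + x.1 1 * b.2 + x.2 * w.2) := by
    rw [hx, h3]
    apply ext_coords <;> simp [h40, h41]
  have k (x y : N3R) := hφ x y
  simp only [hc, toProduct_apply] at k
  have k11 := k e₁ e₁
  have k12 := k e₁ e₂
  have k21 := k e₂ e₁
  have k22 := k e₂ e₂
  have k14 := k e₁ e₄
  have k24 := k e₂ e₄
  have k44 := k e₄ e₄
  have i0 {x y : N3R} (h : x = y) : x.1 0 = y.1 0 := h ▸ rfl
  have i1 {x y : N3R} (h : x = y) : x.1 1 = y.1 1 := h ▸ rfl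
  have i2 {x y : N3R} (h : x = y) : x.1 2 = y.1 2 := h ▸ rfl
  have i3 {x y : N3R} (h : x = y) : x.2 = y.2 := h ▸ rfl
  simp only [e₁_eq, e₂_eq, e₄_eq] at k11 k12 k21 k22 k14 k24 k44
  have a11 := i0 k11
  have a12 := i0 k12
  have a22 := i0 k22
  have b22 := i1 k22
  have s11 := i2 k11
  have s12 := i2 k12
  have s22 := i2 k22
  have l1 := i2 k14
  have l2 := i2 k24
  have l4 := i2 k44
  have t11 := i3 k11
  have t12 := i3 k12
  have t22 := i3 k22
  simp [mul] at a11 a12 a22 b22 s11 s12 s22 l1 l2 l4 t11 t12 t22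
  have hBc : B.c * a.1 1 = 0 := by
    rcases a11 with h | h <;> simp [h]
  have hAc : A.c * a.1 1 = 0 := by
    rcases b22 with h | h <;> simp [h]
  refine ⟨a.1 0, b.1 0, a.1 1, b.1 1, a.1 2, a.2, b.2, w.2, w.1 2, ⟨hD, hκ, ?_, hAc, hBc,
    ?_, ?_, ?_, ?_, ?_, ?_, ?_, ?_, ?_⟩⟩
  · linear_combination a22
  · linear_combination t11
  · linear_combination t12
  · linear_combination t22
  · linear_combination s11
  · linear_combination s12
  · linear_combination s22
  · linear_combination l1
  · linear_combination l2
  · linear_combination l4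

end Coeffs

/-! ### Reduction of a complete LR-structure to structure constants -/

/-- The centre of `𝔫₃(ℝ) ⊕ ℝ`. -/
def centre : Submodule ℝ N3R where
  carrier := {x | x.1 0 = 0 ∧ x.1 1 = 0}
  add_mem' := by
    rintro x y ⟨h1, h2⟩ ⟨h3, h4⟩
    simp [h1, h2, h3, h4]
  zero_mem' := by simp
  smul_mem' := by
    rintro c x ⟨h1, h2⟩
    simp [h1, h2]

theorem mem_centre {x : N3R} : x ∈ centre ↔ x.1 0 = 0 ∧ x.1 1 = 0 := Iff.rfl

theorem eq_of_mem_centre {x : N3R} (h : x ∈ centre) : x = x.1 2 • e₃ + x.2 • e₄ := by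
  conv_lhs => rw [eq_sum x, h.1, h.2]
  simp

theorem lie_e₁_e₂ : ⁅e₁, e₂⁆ = e₃ := by
  rw [lie_eq_vec, e₁_eq, e₂_eq, e₃_eq]
  simp

section LR

variable {μ : N3R →ₗ[ℝ] N3R →ₗ[ℝ] N3R}

/-- Left multiplications of an LR-structure are derivations. -/
theorem mul_lie (h : IsLRStructure ℝ N3R μ) (x y z : N3R) :
    μ x ⁅y, z⁆ = ⁅μ x y, z⁆ + ⁅y, μ x z⁆ := by
  rw [h.lie_eq, h.lie_eq, h.lie_eq, map_sub, h.left_comm x y z, h.left_comm x z y,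
    h.right_comm x y z]
  abel

/-- A derivation acts on `⁅e₁, e₂⁆` through its trace on the quotient by the centre. -/
theorem mul_e₃_eq_smul (h : IsLRStructure ℝ N3R μ) (x : N3R) :
    μ x e₃ = ((μ x e₁).1 0 + (μ x e₂).1 1) • e₃ := by
  rw [← lie_e₁_e₂, mul_lie h, lie_e₁_e₂, lie_eq_vec, lie_eq_vec, e₁_eq, e₂_eq, e₃_eq]
  apply ext_coords <;> simp

theorem trace_eq_zero (h : IsCompleteLRStructure ℝ N3R μ) (x : N3R) :
    (μ x e₁).1 0 + (μ x e₂).1 1 = 0 := by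
  refine eq_zero_of_isNilpotent_of_sub_smul_mem (h.complete x) (N := ⊥) (w := e₃) ?_ ?_ ?_
  · simp
  · exact basis.ne_zero 2
  · rw [mul_e₃_eq_smul h.toIsLRStructure, sub_self]
    exact Submodule.zero_mem _

theorem mul_e₃ (h : IsCompleteLRStructure ℝ N3R μ) (x : N3R) : μ x e₃ = 0 := by
  rw [mul_e₃_eq_smul h.toIsLRStructure, trace_eq_zero h, zero_smul]

theorem mul_comm_of_mem_centre (h : IsLRStructure ℝ N3R μ) {z : N3R} (hz : z ∈ centre) (x : N3R) :
    μ z x = μ x z := by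
  have := h.lie_eq z x
  rw [lie_eq_vec, hz.1, hz.2] at this
  rw [← sub_eq_zero, ← this]
  simp

theorem e₃_mem_centre : e₃ ∈ centre := by
  rw [e₃_eq]
  exact ⟨rfl, rfl⟩

theorem e₄_mem_centre : e₄ ∈ centre := by
  rw [e₄_eq]
  exact ⟨rfl, rfl⟩

theorem e₃_mul (h : IsCompleteLRStructure ℝ N3R μ) (x : N3R) : μ e₃ x = 0 := by
  rw [mul_comm_of_mem_centre h.toIsLRStructure e₃_mem_centre, mul_e₃ h]

/-- Derivations preserve the centre. -/
theorem mul_e₄_mem_centre (h : IsLRStructure ℝ N3R μ) (x : N3R) : μ x e₄ ∈ centre := by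
  have h4 (y : N3R) : ⁅e₄, y⁆ = 0 := by
    rw [lie_eq_vec, e₄_mem_centre.1, e₄_mem_centre.2]
    simp
  have key (y : N3R) : ⁅μ x e₄, y⁆ = 0 := by
    have := mul_lie h x e₄ y
    rwa [h4, h4, map_zero, add_zero, eq_comm] at this
  constructor
  · simpa [lie_eq_vec, e₂_eq] using congrArg (fun x : N3R => x.1 2) (key e₂)
  · simpa [lie_eq_vec, e₁_eq] using congrArg (fun x : N3R => x.1 2) (key e₁)

theorem mul_mem_centre (h : IsCompleteLRStructure ℝ N3R μ) (x : N3R) {z : N3R} (hz : z ∈ centre) :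
    μ x z ∈ centre := by
  rw [eq_of_mem_centre hz, map_add, map_smul, map_smul, mul_e₃ h, smul_zero, zero_add]
  exact centre.smul_mem _ (mul_e₄_mem_centre h.toIsLRStructure x)

/-- Modulo `ℝ e₃`, the vector `e₄` is an eigenvector of a nilpotent map, so its eigenvalue vanishes.
-/
theorem mul_e₄ (h : IsCompleteLRStructure ℝ N3R μ) (x : N3R) : μ x e₄ = (μ x e₄).1 2 • e₃ := by
  have h1 := eq_of_mem_centre (mul_e₄_mem_centre h.toIsLRStructure x)
  have h2 : (μ x e₄).2 = 0 := by
    refine eq_zero_of_isNilpotent_of_sub_smul_mem (h.complete x) (N := Submodule.span ℝ {e₃})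
      (w := e₄) ?_ ?_ ?_
    · intro v hv
      obtain ⟨r, rfl⟩ := Submodule.mem_span_singleton.1 hv
      rw [map_smul, mul_e₃ h, smul_zero]
      exact Submodule.zero_mem _
    · intro hv
      obtain ⟨r, hr⟩ := Submodule.mem_span_singleton.1 hv
      simpa [e₃_eq, e₄_eq] using congrArg (fun x : N3R => x.2) hr
    · rw [← eq_sub_of_add_eq h1.symm]
      exact Submodule.mem_span_singleton.2 ⟨_, rfl⟩
  rw [h2, zero_smul, add_zero] at h1
  exact h1

theorem e₄_mul (h : IsCompleteLRStructure ℝ N3R μ) (x : N3R) : μ e₄ x = (μ x e₄).1 2 • e₃ := by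
  rw [mul_comm_of_mem_centre h.toIsLRStructure e₄_mem_centre, ← mul_e₄ h]

/-- A basis `f₁, f₂` of a complement of the centre with `f₂ · f₂ = c f₁` modulo the centre, in which
`f₁` annihilates everything modulo the centre, yields structure constants. -/
theorem exists_coeffs_of_basis (h : IsCompleteLRStructure ℝ N3R μ) {f₁ f₂ : N3R} {c : ℝ}
    (hD : f₁.1 0 * f₂.1 1 - f₁.1 1 * f₂.1 0 ≠ 0) (h11 : μ f₁ f₁ ∈ centre)
    (h12 : μ f₁ f₂ ∈ centre) (h22 : μ f₂ f₂ - c • f₁ ∈ centre) :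
    ∃ A : Coeffs, A.c = c ∧ (μ f₂ f₂ = c • f₁ → A.s22 = 0 ∧ A.b22 = 0) ∧
      AlgebraIso μ A.toProduct := by
  set D := f₁.1 0 * f₂.1 1 - f₁.1 1 * f₂.1 0 with hDdef
  -- The third vector of the adapted basis is `⁅f₁, f₂⁆ = D • e₃`, hence the divisions by `D`;
  -- subtracting `1 / 2` removes the antisymmetric part.
  refine ⟨⟨c, (μ f₁ f₁).1 2 / D, (μ f₁ f₂).1 2 / D - 1 / 2, (μ f₂ f₂ - c • f₁).1 2 / D,
    (μ f₁ e₄).1 2 / D, (μ f₂ e₄).1 2 / D, (μ e₄ e₄).1 2 / D, (μ f₁ f₁).2, (μ f₁ f₂).2,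
    (μ f₂ f₂ - c • f₁).2⟩, rfl, fun h0 => ?_, AlgebraIso.symm ?_⟩
  · rw [h0, sub_self]
    exact ⟨zero_div _, rfl⟩
  have k11 := eq_of_mem_centre h11
  have k12 := eq_of_mem_centre h12
  have k21 : μ f₂ f₁ = μ f₁ f₂ - D • e₃ := by
    have : ⁅f₁, f₂⁆ = D • e₃ := by
      rw [lie_eq_vec, e₃_eq]
      apply ext_coords <;> simp [hDdef]
    rw [← this, h.lie_eq]
    abel
  have k22 := eq_add_of_sub_eq (eq_of_mem_centre h22)
  have k14 := mul_e₄ h f₁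
  have k24 := mul_e₄ h f₂
  have k44 := mul_e₄ h e₄
  have k41 := e₄_mul h f₁
  have k42 := e₄_mul h f₂
  generalize (μ f₁ f₁).1 2 = q11 at *
  generalize (μ f₁ f₂).1 2 = q12 at *
  generalize (μ f₂ f₂ - c • f₁).1 2 = q22 at *
  generalize (μ f₁ f₁).2 = b11 at *
  generalize (μ f₁ f₂).2 = b12 at *
  generalize (μ f₂ f₂ - c • f₁).2 = b22 at *
  generalize (μ f₁ e₄).1 2 = l1 at *
  generalize (μ f₂ e₄).1 2 = l2 at *
  generalize (μ e₄ e₄).1 2 = l4 at *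
  let φ : N3R →ₗ[ℝ] N3R :=
    { toFun := fun x => x.1 0 • f₁ + x.1 1 • f₂ + (x.1 2 * D) • e₃ + x.2 • e₄
      map_add' := fun x y => by
        simp only [Prod.fst_add, Prod.snd_add, HeisenbergLie.add_apply]
        module
      map_smul' := fun r x => by
        simp only [Prod.smul_fst, Prod.smul_snd, HeisenbergLie.smul_apply, smul_eq_mul,
          RingHom.id_apply]
        module }
  have hφ (x : N3R) : φ x = x.1 0 • f₁ + x.1 1 • f₂ + (x.1 2 * D) • e₃ + x.2 • e₄ := rfl
  refine algebraIso_of_injective φ (fun x hx => ?_) (fun x y => ?_)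
  · have t0 : (φ x).1 0 = 0 := by rw [hx]; rfl
    have t1 : (φ x).1 1 = 0 := by rw [hx]; rfl
    have t2 : (φ x).1 2 = 0 := by rw [hx]; rfl
    have t3 : (φ x).2 = 0 := by rw [hx]; rfl
    rw [hφ, e₃_eq, e₄_eq] at t0 t1 t2 t3
    simp at t0 t1 t2 t3
    have x0 : x.1 0 = 0 := by
      apply (mul_eq_zero.1 (_ : D * x.1 0 = 0)).resolve_left hD
      rw [hDdef]
      linear_combination f₂.1 1 * t0 - f₂.1 0 * t1
    have x1 : x.1 1 = 0 := by
      apply (mul_eq_zero.1 (_ : D * x.1 1 = 0)).resolve_left hD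
      rw [hDdef]
      linear_combination f₁.1 0 * t1 - f₁.1 1 * t0
    have x2 : x.1 2 = 0 := by simpa [x0, x1, hD] using t2
    have x3 : x.2 = 0 := by simpa [x0, x1] using t3
    exact ext_coords x0 x1 x2 x3
  · rw [Coeffs.toProduct_apply, hφ, hφ x, hφ y]
    simp only [Coeffs.mul, vec_zero, vec_one, vec_two, vec_three, map_add, map_smul,
      LinearMap.add_apply, LinearMap.smul_apply]
    rw [k21, k11, k12, k22, k14, k24, k44, k41, k42]
    simp only [mul_e₃ h, e₃_mul h]
    match_scalars <;> field_simp <;> ring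

/-- A complete LR-structure is given by structure constants. -/
theorem exists_coeffs (h : IsCompleteLRStructure ℝ N3R μ) :
    ∃ A : Coeffs, (A.c = 0 ∨ A.c = 1 ∧ A.s22 = 0 ∧ A.b22 = 0) ∧ AlgebraIso μ A.toProduct := by
  have hmod (x y : N3R) : μ x y - (y.1 0 • μ x e₁ + y.1 1 • μ x e₂) ∈ centre := by
    have : μ x y - (y.1 0 • μ x e₁ + y.1 1 • μ x e₂) = y.2 • μ x e₄ := by
      conv_lhs => enter [1]; rw [eq_sum y]
      simp only [map_add, map_smul, mul_e₃ h]
      module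
    rw [this]
    exact centre.smul_mem _ (mul_e₄_mem_centre h.toIsLRStructure x)
  have hcomm (x y : N3R) : μ x y - μ y x ∈ centre := by
    rw [← h.lie_eq, lie_eq_vec]
    exact ⟨rfl, rfl⟩
  have m0 (x y : N3R) : (μ x y).1 0 = y.1 0 * (μ x e₁).1 0 + y.1 1 * (μ x e₂).1 0 :=
    sub_eq_zero.1 (hmod x y).1
  have m1 (x y : N3R) : (μ x y).1 1 = y.1 0 * (μ x e₁).1 1 + y.1 1 * (μ x e₂).1 1 :=
    sub_eq_zero.1 (hmod x y).2
  have c0 (x y : N3R) : (μ x y).1 0 = (μ y x).1 0 := sub_eq_zero.1 (hcomm x y).1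
  have c1 (x y : N3R) : (μ x y).1 1 = (μ y x).1 1 := sub_eq_zero.1 (hcomm x y).2
  have tr1 := trace_eq_zero h e₁
  have tr2 := trace_eq_zero h e₂
  obtain ⟨a, ha⟩ : ∃ a, a = (μ e₁ e₁).1 0 := ⟨_, rfl⟩
  obtain ⟨b, hb⟩ : ∃ b, b = (μ e₁ e₂).1 0 := ⟨_, rfl⟩
  obtain ⟨d, hd⟩ : ∃ d, d = (μ e₂ e₂).1 0 := ⟨_, rfl⟩
  obtain ⟨s, hs⟩ : ∃ s, s = (μ e₁ e₁).1 1 := ⟨_, rfl⟩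
  have ha' : (μ e₁ e₂).1 1 = -a := by linear_combination tr1 + ha
  have hb' : (μ e₂ e₂).1 1 = -b := by linear_combination tr2 + hb - c0 e₂ e₁
  have f0 (x y : N3R) : (μ x y).1 0
      = x.1 0 * y.1 0 * a + (x.1 0 * y.1 1 + x.1 1 * y.1 0) * b + x.1 1 * y.1 1 * d := by
    rw [m0, c0 x e₁, c0 x e₂, m0 e₁ x, m0 e₂ x, c0 e₂ e₁, ← ha, ← hb, ← hd]
    ring
  have f1 (x y : N3R) : (μ x y).1 1
      = x.1 0 * y.1 0 * s - (x.1 0 * y.1 1 + x.1 1 * y.1 0) * a - x.1 1 * y.1 1 * b := by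
    rw [m1, c1 x e₁, c1 x e₂, m1 e₁ x, m1 e₂ x, c1 e₂ e₁, ha', hb', ← hs]
    ring
  -- By Cayley–Hamilton a traceless 2 × 2 matrix has scalar square; here the scalar is `a ^ 2 + b *
  -- s`, and nilpotency kills it. The same applies to `e₂` in `d2`.
  have d1 : a ^ 2 + b * s = 0 := by
    refine eq_zero_of_isNilpotent_of_sub_smul_mem ((h.complete e₁).pow_succ 1) (N := centre)
      (w := e₁) (fun v hv => mul_mem_centre h _ (mul_mem_centre h _ hv)) ?_ ?_
    · simp [mem_centre, e₁_eq]
    · rw [pow_two, Module.End.mul_apply]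
      constructor <;> simp [f0, f1, e₁_eq] <;> ring
  have d2 : b ^ 2 - a * d = 0 := by
    refine eq_zero_of_isNilpotent_of_sub_smul_mem ((h.complete e₂).pow_succ 1) (N := centre)
      (w := e₂) (fun v hv => mul_mem_centre h _ (mul_mem_centre h _ hv)) ?_ ?_
    · simp [mem_centre, e₂_eq]
    · rw [pow_two, Module.End.mul_apply]
      constructor <;> simp [f0, f1, e₂_eq] <;> ring
  have d3 : s * d + a * b = 0 := by
    have := congrArg (fun x : N3R => x.1 1) (h.left_comm e₁ e₂ e₂)
    simp [f0, f1, e₁_eq, e₂_eq] at this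
    linear_combination this
  clear m0 m1 c0 c1 hmod hcomm tr1 tr2 ha hb hd hs ha' hb'
  by_cases hd0 : d = 0
  · have hb0 : b = 0 := by simpa [hd0] using d2
    have ha0 : a = 0 := by simpa [hb0] using d1
    subst hd0 hb0 ha0
    by_cases hs0 : s = 0
    · subst hs0
      obtain ⟨A, hA, -, hiso⟩ := exists_coeffs_of_basis h (f₁ := e₁) (f₂ := e₂) (c := 0)
        (by simp [e₁_eq, e₂_eq]) (by simp [mem_centre, f0, f1]) (by simp [mem_centre, f0, f1])
        (by simp [mem_centre, f0, f1])
      exact ⟨A, Or.inl hA, hiso⟩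
    -- Now `e₁ · e₁` is `s e₂` modulo the centre, so `e₁` plays the role of `f₂`. Taking `f₁` to be
    -- the exact square makes `s22` and `b22` vanish.
    · obtain ⟨A, hA, hA', hiso⟩ := exists_coeffs_of_basis h (f₁ := μ e₁ e₁) (f₂ := e₁) (c := 1)
        (by simp [f0, f1, e₁_eq, hs0]) (by simp [mem_centre, f0, f1])
        (by simp [mem_centre, f0, f1, e₁_eq]) (by simp)
      exact ⟨A, Or.inr ⟨hA, hA' (by simp)⟩, hiso⟩
  · obtain ⟨A, hA, hA', hiso⟩ := exists_coeffs_of_basis h (f₁ := μ e₂ e₂) (f₂ := e₂) (c := 1)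
      (by simp [f0, f1, e₂_eq, hd0]) (by simp [mem_centre, f0, f1, e₂_eq]; grind)
      (by simp [mem_centre, f0, f1, e₂_eq]; grind) (by simp)
    exact ⟨A, Or.inr ⟨hA, hA' (by simp)⟩, hiso⟩

end LR
end N3R

/-! ### Normal forms -/

theorem exists_binary_form_ne_zero {a b c : ℝ} (h : ¬(a = 0 ∧ b = 0 ∧ c = 0)) :
    ∃ x y : ℝ, a * x ^ 2 + 2 * b * x * y + c * y ^ 2 ≠ 0 := by
  by_contra! H
  have h1 := H 1 0
  have h2 := H 0 1
  have h3 := H 1 1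
  exact h ⟨by linarith, by linarith, by linarith⟩

/-- The diagonal entries of a binary form with respect to some orthogonal frame coincide. -/
theorem exists_rotation_diag_eq (h k : ℝ) :
    ∃ x y : ℝ, x ^ 2 + y ^ 2 ≠ 0 ∧ h * (x ^ 2 - y ^ 2) + 2 * k * x * y = 0 := by
  by_cases hh : h = 0
  · exact ⟨1, 0, by norm_num, by simp [hh]⟩
  · have hR : √(h ^ 2 + k ^ 2) ^ 2 = h ^ 2 + k ^ 2 := Real.sq_sqrt (by positivity)
    -- With `x = h` the equation becomes `y ^ 2 - 2 * k * y - h ^ 2 = 0`.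
    refine ⟨h, k + √(h ^ 2 + k ^ 2), ?_, ?_⟩
    · positivity
    · linear_combination -h * hR

theorem add_sq_ne_zero_of_form_ne_zero {a b c x y : ℝ}
    (h : a * x ^ 2 + 2 * b * x * y + c * y ^ 2 ≠ 0) : x ^ 2 + y ^ 2 ≠ 0 := by
  intro h0
  have hx : x = 0 := by nlinarith [sq_nonneg x, sq_nonneg y]
  have hy : y = 0 := by nlinarith [sq_nonneg x, sq_nonneg y]
  simp [hx, hy] at h

namespace N3R

namespace Coeffs

/-- The product with structure constants `A` is isomorphic to a member of the list, where the
range of the seventh family is restricted to `α ≤ -1/4`. -/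
def IsClassified (A : Coeffs) : Prop :=
  ∃ F : Family, F.InRange ∧ (∀ α : ℝ, F = .A7 α → α ≤ -1 / 4) ∧
    AlgebraIso A.toProduct F.coeffs.toProduct

theorem IsClassified.of_iso {A B : Coeffs} (hB : B.IsClassified)
    (h : AlgebraIso A.toProduct B.toProduct) : A.IsClassified := by
  obtain ⟨F, h1, h2, h3⟩ := hB
  exact ⟨F, h1, h2, h.trans h3⟩

/-- At most one of `l4`, `b12` is nonzero: `l4 ≠ 0` leads to `A₁`, `b12 ≠ 0` to `A₂`, and neither to
`A₃`. Since `c = 1` forces `p11 = p22 ^ 2`, the scalings below are powers of a single parameter. -/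
theorem isClassified_of_c_eq_one {s12 l2 l4 b12 : ℝ} (h : b12 * l4 = 0) :
    IsClassified ⟨1, b12 * l2, s12, 0, 0, l2, l4, 0, b12, 0⟩ := by
  by_cases h4 : l4 = 0
  · subst h4
    by_cases hb : b12 = 0
    · subst hb
      by_cases h2 : l2 = 0
      · subst h2
        refine ⟨.A3 (s12 + 1 / 2) 0, Or.inl rfl, by simp, ?_⟩
        simp only [Family.coeffs, add_sub_cancel_right, zero_mul]
        exact AlgebraIso.refl _
      · refine ⟨.A3 (s12 + 1 / 2) 1, Or.inr rfl, by simp, IsIntertwiner.algebraIso (p11 := 1)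
          (p12 := 0) (p21 := 0) (p22 := 1) (u := 0) (v1 := 0) (v2 := 0) (κ := l2) (d := 0) ?_⟩
        constructor <;> simp [Family.coeffs, h2]
    · by_cases h2 : l2 = 0
      · subst h2
        refine ⟨.A2 0, Or.inl rfl, by simp, IsIntertwiner.algebraIso (p11 := 1)
          (p12 := 0) (p21 := 0) (p22 := 1) (u := 0) (v1 := 0) (v2 := 0) (κ := 1 / b12)
          (d := (-1 / 2 - s12) / b12) ?_⟩
        constructor <;> simp [Family.coeffs, hb]
      · refine ⟨.A2 1, Or.inr rfl, by simp, IsIntertwiner.algebraIso (p11 := (l2 * b12) ^ 2)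
          (p12 := 0) (p21 := 0) (p22 := l2 * b12) (u := 0) (v1 := 0) (v2 := 0)
          (κ := l2 ^ 3 * b12 ^ 2) (d := (-1 / 2 - s12) * l2 ^ 3 * b12 ^ 2) ?_⟩
        constructor <;> simp [Family.coeffs, hb, h2] <;> ring
  · obtain rfl : b12 = 0 := (mul_eq_zero.1 h).resolve_right h4
    refine ⟨.A1 (s12 + 1 / 2), trivial, by simp, IsIntertwiner.algebraIso (p11 := l4 ^ 2)
      (p12 := 0) (p21 := 0) (p22 := l4) (u := l2 ^ 2 * l4 ^ 2) (v1 := 0) (v2 := l2 * l4)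
      (κ := l4 ^ 2) (d := 0) ?_⟩
    constructor <;> simp [Family.coeffs, h4] <;> ring

/-- `A₇(α)` and `A₆(-α)` are isomorphic for `α > -1/4`. -/
theorem algebraIso_A6_A7 {α : ℝ} (h : -1 / 4 < α) :
    AlgebraIso (Family.A6 (-α)).coeffs.toProduct (Family.A7 α).coeffs.toProduct := by
  have hpos : 0 < 4 * α + 1 := by linarith
  have hs : √(4 * α + 1) ^ 2 = 4 * α + 1 := Real.sq_sqrt hpos.le
  have hs0 : √(4 * α + 1) ≠ 0 := (Real.sqrt_pos.2 hpos).ne'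
  -- The `s`-form of `A₇(α)` takes the positive value `4 * α + 1` at `(2, -1)`, the image of `e₂`;
  -- this is also the determinant, and `κ` is its square root.
  refine IsIntertwiner.algebraIso (p11 := -1) (p12 := 2)
      (p21 := -(2 * α)) (p22 := -1) (u := 0) (v1 := 0) (v2 := 0) (κ := √(4 * α + 1)) (d := 0) ?_
  constructor <;> simp [Family.coeffs, hs0] <;> grind

/-- Send `e₂` to a vector where `s` has a nonzero value `q`. Since `κ ^ 2 * l4` is the determinant,
the sign `ε` of `q / l4` decides between `A₆` and `A₇`. -/
theorem isClassified_of_l4_ne_zero {s11 s12 s22 l4 : ℝ} (h : l4 ≠ 0) :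
    IsClassified ⟨0, s11, s12, s22, 0, 0, l4, 0, 0, 0⟩ := by
  by_cases hs : s11 = 0 ∧ s12 = 0 ∧ s22 = 0
  · obtain ⟨rfl, rfl, rfl⟩ := hs
    refine ⟨.A8, trivial, by simp, AlgebraIso.symm (IsIntertwiner.algebraIso (p11 := 1)
      (p12 := 0) (p21 := 0) (p22 := l4) (u := 0) (v1 := 0) (v2 := 0) (κ := 1) (d := 0) ?_)⟩
    constructor <;> simp [Family.coeffs, h]
  obtain ⟨x, y, hq⟩ := exists_binary_form_ne_zero hs
  have hN := add_sq_ne_zero_of_form_ne_zero hq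
  have key (ε : ℝ) (hε : ε = 1 ∨ ε = -1)
      (hpos : 0 < ε * (s11 * x ^ 2 + 2 * s12 * x * y + s22 * y ^ 2) / l4) :
      ∃ α : ℝ, AlgebraIso (toProduct ⟨0, s11, s12, s22, 0, 0, l4, 0, 0, 0⟩)
        (toProduct ⟨0, α, -1 / 2, ε, 0, 0, 1, 0, 0, 0⟩) := by
    set q := s11 * x ^ 2 + 2 * s12 * x * y + s22 * y ^ 2 with hqdef
    have hR : √(ε * q / l4) ^ 2 = ε * q / l4 := Real.sq_sqrt hpos.le
    have hR0 : √(ε * q / l4) ≠ 0 := (Real.sqrt_pos.2 hpos).ne'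
    obtain ⟨g0, g1, hg⟩ : ∃ g0 g1 : ℝ, g0 * y - g1 * x = 1 :=
      ⟨y / (x ^ 2 + y ^ 2), -x / (x ^ 2 + y ^ 2), by field_simp; ring⟩
    have hε2 : ε ^ 2 = 1 := by rcases hε with rfl | rfl <;> norm_num
    have hε0 : ε ≠ 0 := by rcases hε with rfl | rfl <;> norm_num
    -- Adding `t • (x, y)` to `ε * q • (g0, g1)` keeps the determinant `ε * q`; this `t` gives the
    -- mixed `s`-coefficient its normal value `-1 / 2`.
    obtain ⟨t, ht⟩ : ∃ t, t = ε * (-1 / 2 - (s11 * g0 * x + s12 * (g0 * y + g1 * x) + s22 * g1 * y)) :=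
      ⟨_, rfl⟩
    obtain ⟨a, ha⟩ : ∃ a, a = ε * q * g0 + t * x := ⟨_, rfl⟩
    obtain ⟨b, hb⟩ : ∃ b, b = ε * q * g1 + t * y := ⟨_, rfl⟩
    have hD : a * y - b * x = ε * q := by
      rw [ha, hb]
      linear_combination ε * q * hg
    refine ⟨(s11 * a ^ 2 + 2 * s12 * a * b + s22 * b ^ 2) / (ε * q),
      AlgebraIso.symm (IsIntertwiner.algebraIso (p11 := a)
      (p12 := x) (p21 := b) (p22 := y) (u := 0) (v1 := 0) (v2 := 0)
      (κ := √(ε * q / l4)) (d := 0) ?_)⟩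
    constructor <;> simp [hR0, hD, hq, hε0, -one_div]
    · field_simp
    · rw [ha, hb, ht]
      linear_combination (ε / 2 + ε * (s11 * g0 * x + s12 * (g0 * y + g1 * x) + s22 * g1 * y)) * hqdef
    · linear_combination hqdef + q * hε2
    · rw [hR]
      field_simp
  rcases lt_or_gt_of_ne (div_ne_zero hq h) with hlt | hgt
  · obtain ⟨α, hα⟩ := key (-1) (Or.inr rfl) (by rw [neg_one_mul, neg_div]; linarith)
    rcases le_or_gt α (-1 / 4) with hle | hlt'
    · exact ⟨.A7 α, show α ≤ 3 / 4 by linarith, by simpa using hle, hα⟩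
    · exact ⟨.A6 (-α), trivial, by simp, hα.trans (algebraIso_A6_A7 hlt').symm⟩
  · obtain ⟨α, hα⟩ := key 1 (Or.inl rfl) (by rwa [one_mul])
    exact ⟨.A6 α, trivial, by simp, hα⟩

/-- Shears along `e₄` clear `s11` and set `s12` to `-1 / 2`; diagonal scalings then normalise `s22`
and `k` to `0` or `1`. -/
theorem isClassified_of_l1_eq_one {s11 s12 s22 k : ℝ} :
    IsClassified ⟨0, s11, s12, s22, 1, 0, 0, k, 0, 0⟩ := by
  have key (α k' p r : ℝ) (hp : p ≠ 0) (hr : r ≠ 0) (h1 : p * α = r * s22)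
      (h2 : r * k' = k * p ^ 2) : AlgebraIso (toProduct ⟨0, s11, s12, s22, 1, 0, 0, k, 0, 0⟩)
        (toProduct ⟨0, 0, -1 / 2, α, 1, 0, 0, k', 0, 0⟩) := by
    refine AlgebraIso.symm (IsIntertwiner.algebraIso (p11 := p)
      (p12 := 0) (p21 := 0) (p22 := r) (u := 0) (v1 := -p * s11 / 2) (v2 := -r / 2 - r * s12)
      (κ := r) (d := 0) ?_)
    constructor <;> simp [hp, hr] <;> grind
  by_cases hk : k = 0
  · subst hk
    by_cases hs : s22 = 0
    · exact ⟨.A5 0, Or.inl rfl, by simp, key 0 0 1 1 (by simp) (by simp) (by simp [hs]) (by simp)⟩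
    · exact ⟨.A5 1, Or.inr rfl, by simp, key 1 0 1 (1 / s22) (by simp) (by simp [hs])
        (by simp [hs]) (by simp)⟩
  · by_cases hs : s22 = 0
    · exact ⟨.A4 0, Or.inl rfl, by simp, key 0 1 1 k (by simp) hk (by simp [hs]) (by simp)⟩
    · exact ⟨.A4 1, Or.inr rfl, by simp, key 1 1 (1 / (k * s22)) (1 / (k * s22 ^ 2))
        (by simp [hs, hk]) (by simp [hs, hk]) (by field_simp) (by field_simp)⟩

/-- Here `κ` is unconstrained, so a nonzero value of `s` can be normalised whatever its sign, by a
basis whose determinant equals that value. -/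
theorem isClassified_of_b_eq_zero {s11 s12 s22 : ℝ} :
    IsClassified ⟨0, s11, s12, s22, 0, 0, 0, 0, 0, 0⟩ := by
  by_cases hs : s11 = 0 ∧ s12 = 0 ∧ s22 = 0
  · obtain ⟨rfl, rfl, rfl⟩ := hs
    exact ⟨.A14, trivial, by simp, AlgebraIso.refl _⟩
  obtain ⟨x, y, hq⟩ := exists_binary_form_ne_zero hs
  have hN := add_sq_ne_zero_of_form_ne_zero hq
  set q := s11 * x ^ 2 + 2 * s12 * x * y + s22 * y ^ 2 with hqdef
  obtain ⟨g0, g1, hg⟩ : ∃ g0 g1 : ℝ, x * g1 - y * g0 = 1 :=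
    ⟨-y / (x ^ 2 + y ^ 2), x / (x ^ 2 + y ^ 2), by field_simp; ring⟩
  obtain ⟨t, ht⟩ : ∃ t, t = -1 / 2 - (s11 * g0 * x + s12 * (g0 * y + g1 * x) + s22 * g1 * y) :=
    ⟨_, rfl⟩
  obtain ⟨a, ha⟩ : ∃ a, a = q * g0 + t * x := ⟨_, rfl⟩
  obtain ⟨b, hb⟩ : ∃ b, b = q * g1 + t * y := ⟨_, rfl⟩
  have hD : x * b - y * a = q := by
    rw [ha, hb]
    linear_combination q * hg
  refine ⟨.A13 ((s11 * a ^ 2 + 2 * s12 * a * b + s22 * b ^ 2) / q), trivial, by simp,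
    AlgebraIso.symm (IsIntertwiner.algebraIso (p11 := x)
    (p12 := a) (p21 := y) (p22 := b) (u := 0) (v1 := 0) (v2 := 0) (κ := 1) (d := 0) ?_)⟩
  constructor <;> simp [Family.coeffs, hD, hq, -one_div]
  · exact hqdef
  · rw [ha, hb, ht]
    linear_combination (1 / 2 + (s11 * g0 * x + s12 * (g0 * y + g1 * x) + s22 * g1 * y)) * hqdef
  · field_simp

/-- The form `b` sees only the `e₁`-coordinate, so adding a multiple of `e₂` to `e₁` adjusts `s12`
when `q ≠ 0`; the parameter `d` absorbs the resulting `s11`. -/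
theorem isClassified_of_rank_one {p q : ℝ} :
    IsClassified ⟨0, 0, p, q, 0, 0, 0, 1, 0, 0⟩ := by
  by_cases hq : q = 0
  · subst hq
    refine ⟨.A11 (p + 1 / 2), trivial, by simp, ?_⟩
    simp only [Family.coeffs, add_sub_cancel_right]
    exact AlgebraIso.refl _
  · refine ⟨.A12, trivial, by simp, AlgebraIso.symm (IsIntertwiner.algebraIso (p11 := 1)
      (p12 := 0) (p21 := (-1 / 2 - p) / q) (p22 := 1 / q) (u := 0) (v1 := 0) (v2 := 0) (κ := 1)
      (d := 2 * p * ((-1 / 2 - p) / q) + q * ((-1 / 2 - p) / q) ^ 2) ?_)⟩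
    constructor <;> simp [Family.coeffs, hq] <;> field_simp
    ring

/-- Exchanging `e₁` and `e₂` changes the sign of the `e₃`-form. -/
theorem algebraIso_neg_s12 {a ε : ℝ} (hε : ε = 1 ∨ ε = -1) :
    AlgebraIso (toProduct ⟨0, 0, a, 0, 0, 0, 0, 1, 0, ε⟩)
      (toProduct ⟨0, 0, -a, 0, 0, 0, 0, 1, 0, ε⟩) := by
  refine IsIntertwiner.algebraIso (p11 := 0)
    (p12 := 1) (p21 := 1) (p22 := 0) (u := 0) (v1 := 0) (v2 := 0) (κ := ε) (d := 0) ?_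
  rcases hε with rfl | rfl <;> constructor <;> simp

theorem isClassified_of_s_antidiag {a ε : ℝ} (hε : ε = 1 ∨ ε = -1) :
    IsClassified ⟨0, 0, a, 0, 0, 0, 0, 1, 0, ε⟩ := by
  have key (a : ℝ) (ha : 0 ≤ a) : IsClassified ⟨0, 0, a, 0, 0, 0, 0, 1, 0, ε⟩ := by
    rcases hε with rfl | rfl
    · refine ⟨.A9 (a + 1 / 2), show 1 / 2 ≤ a + 1 / 2 by linarith, by simp, ?_⟩
      simp only [Family.coeffs, add_sub_cancel_right]
      exact AlgebraIso.refl _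
    · refine ⟨.A10 (a + 1 / 2), show 1 / 2 ≤ a + 1 / 2 by linarith, by simp, ?_⟩
      simp only [Family.coeffs, add_sub_cancel_right]
      exact AlgebraIso.refl _
  rcases le_total 0 a with h | h
  · exact key a h
  · exact (key (-a) (by linarith)).of_iso (algebraIso_neg_s12 hε)

/-- A similarity preserves `b` up to scale. Rotate until the diagonal entries of `s` agree, then
subtract a multiple of `b`. -/
theorem isClassified_of_definite {p q : ℝ} :
    IsClassified ⟨0, 0, p, q, 0, 0, 0, 1, 0, 1⟩ := by
  obtain ⟨x, y, hN, hxy⟩ := exists_rotation_diag_eq (-q) (2 * p)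
  refine (isClassified_of_s_antidiag
    (a := (p * (x ^ 2 - y ^ 2) + q * x * y) / (x ^ 2 + y ^ 2)) (Or.inl rfl)).of_iso
    (AlgebraIso.symm (IsIntertwiner.algebraIso (p11 := x)
      (p12 := -y) (p21 := y) (p22 := x) (u := 0) (v1 := 0) (v2 := 0) (κ := x ^ 2 + y ^ 2)
      (d := 2 * p * x * y + q * y ^ 2) ?_))
  have hN' : x * x + y * y ≠ 0 := by convert hN using 1; ring
  constructor <;> simp [hN, hN'] <;> field_simp <;> first | ring1 | grind

/-- The vectors `(t, 1)` and `(-t, 1)` are `b`-orthogonal. The condition on `s12` becomes `P * t ^ 2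
- t - Q = 0`, with discriminant `R ^ 2`; the root with `+ R` gives the parameter `R ≥ 1`. -/
theorem isClassified_of_indefinite_of_ne_zero {P Q : ℝ} (hP : P ≠ 0) (hPQ : 0 ≤ P * Q) :
    IsClassified ⟨0, P, 0, Q, 0, 0, 0, 0, 1, 0⟩ := by
  have hR : √(1 + 4 * (P * Q)) ^ 2 = 1 + 4 * (P * Q) := Real.sq_sqrt (by linarith)
  have hR1 : 1 ≤ √(1 + 4 * (P * Q)) := Real.one_le_sqrt.2 (by linarith)
  set R := √(1 + 4 * (P * Q))
  obtain ⟨t, ht⟩ : ∃ t, t = (1 + R) / (2 * P) := ⟨_, rfl⟩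
  have ht0 : t ≠ 0 := by
    rw [ht]
    exact div_ne_zero (by linarith) (by simp [hP])
  have htR : 2 * P * t = 1 + R := by
    rw [ht]
    field_simp
  have ht2 : P * t ^ 2 - t - Q = 0 := by
    have : 4 * P * (P * t ^ 2 - t - Q) = 0 := by
      linear_combination (2 * P * t + R - 1) * htR + hR
    simpa [hP] using this
  refine ⟨.A15 R, hR1, by simp, AlgebraIso.symm (IsIntertwiner.algebraIso (p11 := t)
    (p12 := -t) (p21 := 1) (p22 := 1) (u := 0) (v1 := 0) (v2 := 0) (κ := 2 * t)
    (d := P * t ^ 2 + Q) ?_)⟩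
  constructor <;> simp [Family.coeffs, ht0] <;> grind

theorem isClassified_of_indefinite {P Q : ℝ} :
    IsClassified ⟨0, P, 0, Q, 0, 0, 0, 0, 1, 0⟩ := by
  -- If `s` has an isotropic vector `(x, y)` off the null lines of `b`, then `(x, y)` and `(x, -y)`
  -- are `b`-orthogonal and both `s`-isotropic, which gives `A₁₀`.
  have key (x y : ℝ) (hx : x ≠ 0) (hy : y ≠ 0) (h : P * x ^ 2 + Q * y ^ 2 = 0) :
      IsClassified ⟨0, P, 0, Q, 0, 0, 0, 0, 1, 0⟩ := by
    refine (isClassified_of_s_antidiag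
      (a := (Q * y ^ 2 - P * x ^ 2) / (2 * x * y)) (Or.inr rfl)).of_iso
      (AlgebraIso.symm (IsIntertwiner.algebraIso (p11 := x)
        (p12 := x) (p21 := y) (p22 := -y) (u := 0) (v1 := 0) (v2 := 0) (κ := 2 * x * y)
        (d := 0) ?_))
    constructor <;> simp [hx, hy] <;> grind
  rcases lt_or_ge (P * Q) 0 with hlt | hge
  · have hP : P ≠ 0 := by
      rintro rfl
      simp at hlt
    have hQ : Q ≠ 0 := by
      rintro rfl
      simp at hlt
    refine key √|Q| √|P| (by simpa using hQ) (by simpa using hP) ?_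
    rw [Real.sq_sqrt (abs_nonneg _), Real.sq_sqrt (abs_nonneg _)]
    rcases lt_or_gt_of_ne hP with h | h
    · have : 0 < Q := pos_of_mul_neg_right hlt h.le
      rw [abs_of_neg h, abs_of_pos this]
      ring
    · have : Q < 0 := neg_of_mul_neg_right hlt h.le
      rw [abs_of_pos h, abs_of_neg this]
      ring
  · by_cases hP : P = 0
    · by_cases hQ : Q = 0
      · exact key 1 1 one_ne_zero one_ne_zero (by simp [hP, hQ])
      · refine (isClassified_of_indefinite_of_ne_zero (P := -Q) (Q := -P) (by simpa using hQ)
          (by linarith)).of_iso (IsIntertwiner.algebraIso (p11 := 0)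
          (p12 := 1) (p21 := 1) (p22 := 0) (u := 0) (v1 := 0) (v2 := 0) (κ := 1) (d := 0) ?_)
        constructor <;> simp
    · exact isClassified_of_indefinite_of_ne_zero hP hge

/-- Pass to null coordinates of `b`; subtracting a multiple of `b` then diagonalises `s`. -/
theorem isClassified_of_lorentzian {p q : ℝ} :
    IsClassified ⟨0, 0, p, q, 0, 0, 0, 1, 0, -1⟩ := by
  refine (isClassified_of_indefinite (P := -(2 * p + q) / 2) (Q := (2 * p - q) / 2)).of_iso
    (AlgebraIso.symm (IsIntertwiner.algebraIso (p11 := 1)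
      (p12 := 1) (p21 := 1) (p22 := -1) (u := 0) (v1 := 0) (v2 := 0) (κ := 2) (d := -q) ?_))
  constructor <;> norm_num <;> ring

/-- Send `e₁` to a non-isotropic vector of `b` and `e₂` to an orthogonal one scaled by `r`. Then `κ`
normalises `b11`, `d` kills `s11`, and `r` normalises `det b` to `-1`, `0` or `1`. -/
theorem isClassified_of_b_ne_zero {s11 s12 s22 b11 b12 b22 : ℝ}
    (h : ¬(b11 = 0 ∧ b12 = 0 ∧ b22 = 0)) :
    IsClassified ⟨0, s11, s12, s22, 0, 0, 0, b11, b12, b22⟩ := by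
  obtain ⟨x, y, hβ⟩ := exists_binary_form_ne_zero h
  have key (r : ℝ) (hr : r ≠ 0)
      (H : ∀ p q, IsClassified ⟨0, 0, p, q, 0, 0, 0, 1, 0, r ^ 2 * (b11 * b22 - b12 ^ 2)⟩) :
      IsClassified ⟨0, s11, s12, s22, 0, 0, 0, b11, b12, b22⟩ := by
    obtain ⟨a, ha⟩ : ∃ a, a = -(r * (b12 * x + b22 * y)) := ⟨_, rfl⟩
    obtain ⟨b, hb⟩ : ∃ b, b = r * (b11 * x + b12 * y) := ⟨_, rfl⟩
    obtain ⟨d, hd⟩ : ∃ d, d = s11 * x ^ 2 + 2 * s12 * x * y + s22 * y ^ 2 := ⟨_, rfl⟩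
    set β := b11 * x ^ 2 + 2 * b12 * x * y + b22 * y ^ 2 with hβdef
    have hD : x * b - y * a = r * β := by
      rw [ha, hb, hβdef]
      ring
    refine (H ((s11 * x * a + s12 * (x * b + y * a) + s22 * y * b) / (r * β))
      ((s11 * a ^ 2 + 2 * s12 * a * b + s22 * b ^ 2 - d * (r ^ 2 * (b11 * b22 - b12 ^ 2)))
        / (r * β))).of_iso (AlgebraIso.symm (IsIntertwiner.algebraIso (p11 := x)
      (p12 := a) (p21 := y) (p22 := b) (u := 0) (v1 := 0) (v2 := 0) (κ := β) (d := d) ?_))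
    constructor <;> try simp only [hD, zero_mul, mul_zero, zero_add, add_zero, mul_one]
    · exact mul_ne_zero hr hβ
    · exact hβ
    · linear_combination hβdef
    · rw [ha, hb]
      ring
    · rw [ha, hb, hβdef]
      ring
    · linear_combination hd
    · field_simp
    · field_simp
      ring
  rcases lt_trichotomy (b11 * b22 - b12 ^ 2) 0 with hlt | heq | hgt
  · have hpos : 0 < -(b11 * b22 - b12 ^ 2) := by linarith
    refine key (√(-(b11 * b22 - b12 ^ 2)))⁻¹ (inv_ne_zero (Real.sqrt_pos.2 hpos).ne') ?_
    intro p q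
    have : (√(-(b11 * b22 - b12 ^ 2)))⁻¹ ^ 2 * (b11 * b22 - b12 ^ 2) = -1 := by
      rw [inv_pow, Real.sq_sqrt hpos.le, inv_neg, neg_mul, inv_mul_cancel₀ hlt.ne]
    rw [this]
    exact isClassified_of_lorentzian
  · refine key 1 one_ne_zero fun p q => ?_
    rw [heq, mul_zero]
    exact isClassified_of_rank_one
  · refine key (√(b11 * b22 - b12 ^ 2))⁻¹ (inv_ne_zero (Real.sqrt_pos.2 hgt).ne') ?_
    intro p q
    have : (√(b11 * b22 - b12 ^ 2))⁻¹ ^ 2 * (b11 * b22 - b12 ^ 2) = 1 := by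
      rw [inv_pow, Real.sq_sqrt hgt.le, inv_mul_cancel₀ hgt.ne']
    rw [this]
    exact isClassified_of_definite

theorem isClassified {A : Coeffs} (h : A.IsLR)
    (hc : A.c = 0 ∨ A.c = 1 ∧ A.s22 = 0 ∧ A.b22 = 0) : A.IsClassified := by
  obtain ⟨c, s11, s12, s22, l1, l2, l4, b11, b12, b22⟩ := A
  obtain ⟨h1, h2, h3, h4, h5, h6⟩ := h
  dsimp only at *
  rcases hc with rfl | ⟨rfl, rfl, rfl⟩
  · by_cases hl4 : l4 = 0
    · subst hl4
      by_cases hl : l1 ^ 2 + l2 ^ 2 = 0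
      · obtain rfl : l1 = 0 := by nlinarith [sq_nonneg l1, sq_nonneg l2]
        obtain rfl : l2 = 0 := by nlinarith [sq_nonneg l2]
        by_cases hb : b11 = 0 ∧ b12 = 0 ∧ b22 = 0
        · obtain ⟨rfl, rfl, rfl⟩ := hb
          exact isClassified_of_b_eq_zero
        · exact isClassified_of_b_ne_zero hb
      -- The new basis has `l (a, b) = 1`, and `(-l2, l1)` spans the kernel of `l`; the LR equations
      -- then leave only the first entry of `b`.
      · obtain ⟨a, ha⟩ : ∃ a, a = l1 / (l1 ^ 2 + l2 ^ 2) := ⟨_, rfl⟩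
        obtain ⟨b, hb⟩ : ∃ b, b = l2 / (l1 ^ 2 + l2 ^ 2) := ⟨_, rfl⟩
        have hN : a * l1 + b * l2 = 1 := by
          rw [ha, hb]
          field_simp
        refine (isClassified_of_l1_eq_one (s11 := s11 * a ^ 2 + 2 * s12 * a * b + s22 * b ^ 2)
          (s12 := s11 * a * -l2 + s12 * (a * l1 - b * l2) + s22 * b * l1)
          (s22 := s11 * l2 ^ 2 - 2 * s12 * l1 * l2 + s22 * l1 ^ 2)
          (k := b11 * a ^ 2 + 2 * b12 * a * b + b22 * b ^ 2)).of_iso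
          (AlgebraIso.symm (IsIntertwiner.algebraIso (p11 := a)
          (p12 := -l2) (p21 := b) (p22 := l1) (u := 0) (v1 := 0) (v2 := 0) (κ := 1) (d := 0) ?_))
        constructor <;> simp <;> grind
    · obtain rfl : b11 = 0 := (mul_eq_zero.1 h2).resolve_right hl4
      obtain rfl : b12 = 0 := (mul_eq_zero.1 h3).resolve_right hl4
      obtain rfl : b22 = 0 := by simpa [hl4] using h1
      -- Completing the square in the `e₄`-coordinate removes `l1` and `l2`.
      refine (isClassified_of_l4_ne_zero (s11 := s11 - l1 ^ 2 / l4) (s12 := s12 - l1 * l2 / l4)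
        (s22 := s22 - l2 ^ 2 / l4) hl4).of_iso
        (AlgebraIso.symm (IsIntertwiner.algebraIso (p11 := 1)
        (p12 := 0) (p21 := 0) (p22 := 1) (u := 0) (v1 := -l1 / l4) (v2 := -l2 / l4) (κ := 1)
        (d := 0) ?_))
      constructor <;> simp <;> field_simp <;> ring
  · obtain rfl : l1 = 0 := by simpa using h1
    obtain rfl : b11 = 0 := by simpa using h4
    obtain rfl : s11 = b12 * l2 := by simpa using h5
    exact isClassified_of_c_eq_one h3

end Coeffs
end N3R

/-! ### Invariants separating the members of the list -/

namespace N3R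

namespace Coeffs

namespace IsIntertwiner

variable {A B : Coeffs} {p11 p12 p21 p22 u v1 v2 κ d : ℝ}

theorem c_eq_zero (h : IsIntertwiner A B p11 p12 p21 p22 u v1 v2 κ d) (hB : B.c = 0) :
    A.c = 0 := by
  have h1 := h.c1
  have h2 := h.c2
  rw [hB, zero_mul] at h1
  have : A.c * (p11 * p22 - p21 * p12) = 0 := by linear_combination p22 * h1 - p12 * h2
  exact (mul_eq_zero.1 this).resolve_right h.det_ne

theorem l4_eq_zero (h : IsIntertwiner A B p11 p12 p21 p22 u v1 v2 κ d) (hB : B.l4 = 0) :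
    A.l4 = 0 := by
  have h1 := h.l4
  rw [hB, mul_zero] at h1
  exact (mul_eq_zero.1 h1).resolve_left h.det_ne

theorem l_eq_zero (h : IsIntertwiner A B p11 p12 p21 p22 u v1 v2 κ d)
    (hB : B.l1 = 0 ∧ B.l2 = 0 ∧ B.l4 = 0) : A.l1 = 0 ∧ A.l2 = 0 := by
  have h1 := h.l1
  have h2 := h.l2
  simp only [hB.1, hB.2.1, hB.2.2, zero_mul, add_zero, mul_zero] at h1 h2
  exact ⟨(mul_eq_zero.1 h1).resolve_left h.det_ne, (mul_eq_zero.1 h2).resolve_left h.det_ne⟩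

theorem b_eq_zero (h : IsIntertwiner A B p11 p12 p21 p22 u v1 v2 κ d)
    (hB : B.b11 = 0 ∧ B.b12 = 0 ∧ B.b22 = 0) : A.b11 = 0 ∧ A.b12 = 0 := by
  have h1 := h.b11
  have h2 := h.b12
  simp only [hB.1, hB.2.1, hB.2.2, zero_mul, add_zero, mul_zero] at h1 h2
  exact ⟨(mul_eq_zero.1 h1).resolve_left h.κ_ne, (mul_eq_zero.1 h2).resolve_left h.κ_ne⟩

theorem det_b (h : IsIntertwiner A B p11 p12 p21 p22 u v1 v2 κ d) (hA : A.c = 0) :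
    κ ^ 2 * (A.b11 * A.b22 - A.b12 ^ 2)
      = (p11 * p22 - p21 * p12) ^ 2 * (B.b11 * B.b22 - B.b12 ^ 2) := by
  have h1 := h.b11
  have h2 := h.b12
  have h3 := h.b22
  rw [hA, mul_zero, zero_add] at h3
  have : κ ^ 2 * (A.b11 * A.b22 - A.b12 ^ 2) = (κ * A.b11) * (κ * A.b22) - (κ * A.b12) ^ 2 := by
    ring
  rw [this, h1, h2, h3]
  ring

end IsIntertwiner

/-- The discriminant of the pencil spanned by the forms `s` and `b`. -/
def disc (A : Coeffs) : ℝ :=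
  (A.s11 * A.b22 + A.s22 * A.b11 - 2 * A.s12 * A.b12) ^ 2
    - 4 * (A.s11 * A.s22 - A.s12 ^ 2) * (A.b11 * A.b22 - A.b12 ^ 2)

theorem IsIntertwiner.disc_eq {A B : Coeffs} {p11 p12 p21 p22 u v1 v2 κ d : ℝ}
    (h : IsIntertwiner A B p11 p12 p21 p22 u v1 v2 κ d) (hA : A.c = 0)
    (hB : B.l1 = 0 ∧ B.l2 = 0 ∧ B.l4 = 0) :
    κ ^ 2 * A.disc = (p11 * p22 - p21 * p12) ^ 2 * B.disc := by
  have h1 := h.b11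
  have h2 := h.b12
  have h3 := h.b22
  have h4 := h.s11
  have h5 := h.s12
  have h6 := h.s22
  have hD := h.det_ne
  simp only [hA, hB.1, hB.2.1, hB.2.2, zero_mul, add_zero, mul_zero, zero_add] at h1 h2 h3 h4 h5 h6
  set D := p11 * p22 - p21 * p12 with hDdef
  -- The discriminant is unchanged when `s` is replaced by `s + t b`, and is homogeneous of degree
  -- two in each form.
  have key : D ^ 2 * (κ ^ 2 * A.disc) = D ^ 2 * (D ^ 2 * B.disc) := by
    have e1 : D ^ 2 * (κ ^ 2 * A.disc)
        = ((D * A.s11 + d * A.b11) * (κ * A.b22) + (D * A.s22 + d * A.b22) * (κ * A.b11)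
          - 2 * (D * A.s12 + d * A.b12) * (κ * A.b12)) ^ 2
          - 4 * ((D * A.s11 + d * A.b11) * (D * A.s22 + d * A.b22) - (D * A.s12 + d * A.b12) ^ 2)
            * ((κ * A.b11) * (κ * A.b22) - (κ * A.b12) ^ 2) := by
      unfold disc
      ring
    rw [e1, h1, h2, h3, h4, h5, h6, hDdef]
    unfold disc
    ring
  exact mul_left_cancel₀ (pow_ne_zero 2 hD) key

theorem IsIntertwiner.disc_mul_det {A B : Coeffs} {p11 p12 p21 p22 u v1 v2 κ d : ℝ}
    (h : IsIntertwiner A B p11 p12 p21 p22 u v1 v2 κ d) (hA : A.c = 0)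
    (hB : B.l1 = 0 ∧ B.l2 = 0 ∧ B.l4 = 0) :
    A.disc * (B.b11 * B.b22 - B.b12 ^ 2) = B.disc * (A.b11 * A.b22 - A.b12 ^ 2) := by
  have h1 := h.disc_eq hA hB
  have h2 := h.det_b hA
  have hκ := pow_ne_zero 2 h.κ_ne
  have hD := pow_ne_zero 2 h.det_ne
  apply mul_left_cancel₀ (mul_ne_zero hκ hD)
  linear_combination (p11 * p22 - p21 * p12) ^ 2 * (B.b11 * B.b22 - B.b12 ^ 2) * h1
    - (p11 * p22 - p21 * p12) ^ 2 * B.disc * h2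

/-- If `b = 0` and `l₁ = l₂ = 0` then the discriminant of `s` is an invariant. -/
theorem IsIntertwiner.det_s {A B : Coeffs} {p11 p12 p21 p22 u v1 v2 κ d : ℝ}
    (h : IsIntertwiner A B p11 p12 p21 p22 u v1 v2 κ d) (hA : A.c = 0)
    (hA' : A.b11 = 0 ∧ A.b12 = 0 ∧ A.b22 = 0) (hB : B.l1 = 0 ∧ B.l2 = 0)
    (hv : B.l4 * v1 = 0 ∧ B.l4 * v2 = 0) :
    A.s11 * A.s22 - A.s12 ^ 2 = B.s11 * B.s22 - B.s12 ^ 2 := by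
  have h4 := h.s11
  have h5 := h.s12
  have h6 := h.s22
  have hD := h.det_ne
  have e1 : B.l4 * v1 ^ 2 = 0 := by linear_combination v1 * hv.1
  have e2 : B.l4 * v2 ^ 2 = 0 := by linear_combination v2 * hv.2
  simp only [hA, hA', hB, hv.1, e1, e2, zero_mul, add_zero, mul_zero, zero_add] at h4 h5 h6
  set D := p11 * p22 - p21 * p12 with hDdef
  apply mul_left_cancel₀ (pow_ne_zero 2 hD)
  have e3 : D ^ 2 * (A.s11 * A.s22 - A.s12 ^ 2) = (D * A.s11) * (D * A.s22) - (D * A.s12) ^ 2 := by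
    ring
  rw [e3, h4, h5, h6, hDdef]
  ring

end Coeffs

namespace Family

/-- Isomorphism classes: the relation of the classification theorem. -/
def Equivalent (F G : Family) : Prop :=
  F = G ∨ ∃ α : ℝ, -1 / 4 < α ∧ ((F = .A7 α ∧ G = .A6 (-α)) ∨ (F = .A6 (-α) ∧ G = .A7 α))

/-- The number of the family. -/
def index : Family → ℕ
  | A1 _ => 1
  | A2 _ => 2
  | A3 _ _ => 3
  | A4 _ => 4
  | A5 _ => 5
  | A6 _ => 6
  | A7 _ => 7
  | A8 => 8
  | A9 _ => 9
  | A10 _ => 10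
  | A11 _ => 11
  | A12 => 12
  | A13 _ => 13
  | A14 => 14
  | A15 _ => 15

open Coeffs

theorem Equivalent.symm {F G : Family} (h : F.Equivalent G) : G.Equivalent F := by
  rcases h with h | ⟨α, h1, h2⟩
  · exact Or.inl h.symm
  · exact Or.inr ⟨α, h1, by tauto⟩

/-- The vanishing criteria transfer in one direction only, so intertwiners both ways are used;
ordering the indices halves the pairs to be examined. -/
theorem equivalent_of_isIntertwiner_of_index_le {F G : Family} (hF : F.InRange) (hG : G.InRange)
    (hle : G.index ≤ F.index)
    {p11 p12 p21 p22 u v1 v2 κ d p11' p12' p21' p22' u' v1' v2' κ' d' : ℝ}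
    (h : IsIntertwiner F.coeffs G.coeffs p11 p12 p21 p22 u v1 v2 κ d)
    (h' : IsIntertwiner G.coeffs F.coeffs p11' p12' p21' p22' u' v1' v2' κ' d') :
    F.Equivalent G := by
  have c1 := h.c_eq_zero
  have c2 := h'.c_eq_zero
  have l1 := h.l4_eq_zero
  have l2 := h'.l4_eq_zero
  have k1 := h.l_eq_zero
  have k2 := h'.l_eq_zero
  have b1 := h.b_eq_zero
  have b2 := h'.b_eq_zero
  have d1 := h.det_b
  have D1 := h.det_ne
  have hκ := h.κ_ne
  cases F <;> cases G <;> simp [coeffs, index] at c1 c2 l1 l2 k1 k2 b1 b2 d1 hle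
  case A1.A1 α α' =>
    have e1 := h.s12
    have e2 := h.b22
    have e3 := h.c2
    simp [coeffs] at e1 e2 e3
    subst e3
    simp [e2] at e1 D1
    have : α = α' := by
      apply mul_left_cancel₀ (mul_ne_zero D1.1 D1.2)
      linear_combination e1
    exact Or.inl (by rw [this])
  case A2.A2 α α' =>
    rcases hF with rfl | rfl <;> rcases hG with rfl | rfl <;> simp_all [Equivalent]
  case A3.A3 α β α' β' =>
    have e3 := h.c2
    have e5 := h.s12
    have e6 := h.b22
    simp [coeffs] at e3 e5 e6
    subst e3
    simp [e6] at e5 D1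
    have : α = α' := by
      apply mul_left_cancel₀ (mul_ne_zero D1.1 D1.2)
      linear_combination e5
    subst this
    rcases hF with rfl | rfl <;> rcases hG with rfl | rfl <;> simp_all [Equivalent]
  case A4.A4 α α' =>
    have e1 := h.s22
    have e2 := h.l2
    have e3 := h.b22
    simp [coeffs, hκ] at e1 e2 e3
    subst e2
    simp at e1 D1
    rcases hF with rfl | rfl <;> rcases hG with rfl | rfl <;>
      simp [Equivalent, D1, eq_comm (a := (0 : ℝ))] at e1 ⊢
  case A5.A5 α α' =>
    have e1 := h.s22
    have e2 := h.l2
    simp [coeffs, hκ] at e1 e2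
    subst e2
    simp at e1 D1
    rcases hF with rfl | rfl <;> rcases hG with rfl | rfl <;>
      simp [Equivalent, D1, eq_comm (a := (0 : ℝ))] at e1 ⊢
  case A6.A6 α α' =>
    have e1 := h.l1
    have e2 := h.l2
    simp [coeffs, hκ] at e1 e2
    have e3 := h.det_s rfl ⟨rfl, rfl, rfl⟩ ⟨rfl, rfl⟩ (by simp [e1, e2])
    simp [coeffs] at e3
    exact Or.inl (by rw [e3])
  case A7.A6 α α' =>
    have e1 := h.l1
    have e2 := h.l2
    have e4 := h.l4
    have e5 := h.s22
    simp [coeffs, hκ] at e1 e2 e4 e5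
    have e3 := h.det_s rfl ⟨rfl, rfl, rfl⟩ ⟨rfl, rfl⟩ (by simp [e1, e2])
    simp only [coeffs] at e3
    obtain rfl : α' = -α := by linarith
    refine Or.inr ⟨α, ?_, Or.inl ⟨rfl, rfl⟩⟩
    by_contra! hα
    simp only [e2] at e5
    have : 0 < κ ^ 2 := by positivity
    -- For `α ≤ -1 / 4` the target form `-α * p12 ^ 2 - p12 * p22 + p22 ^ 2` is nonnegative, yet it
    -- would have to equal `-κ ^ 2`.
    nlinarith [sq_nonneg (p22 - p12 / 2), mul_nonneg (sub_nonneg.2 hα) (sq_nonneg p12)]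
  case A7.A7 α α' =>
    have e1 := h.l1
    have e2 := h.l2
    simp [coeffs, hκ] at e1 e2
    have e3 := h.det_s rfl ⟨rfl, rfl, rfl⟩ ⟨rfl, rfl⟩ (by simp [e1, e2])
    simp [coeffs] at e3
    exact Or.inl (by rw [e3])
  case A8.A6 α =>
    have e1 := h'.s22
    have e2 := h'.l2
    simp [coeffs, h'.κ_ne] at e1 e2
    simp [e2] at e1
    exact absurd e1 h'.det_ne
  case A8.A7 α =>
    have e1 := h'.s22
    have e2 := h'.l2
    simp [coeffs, h'.κ_ne] at e1 e2
    simp only [e2] at e1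
    exact absurd (by linarith) h'.det_ne
  case A8.A8 => exact Or.inl rfl
  case A9.A9 α α' =>
    have e1 := h.disc_mul_det rfl ⟨rfl, rfl, rfl⟩
    simp only [coeffs, disc] at e1
    have hα : 1 / 2 ≤ α := hF
    have hα' : 1 / 2 ≤ α' := hG
    have : α = α' := by nlinarith
    exact Or.inl (by rw [this])
  case A10.A10 α α' =>
    have e1 := h.disc_mul_det rfl ⟨rfl, rfl, rfl⟩
    simp only [coeffs, disc] at e1
    have hα : 1 / 2 ≤ α := hF
    have hα' : 1 / 2 ≤ α' := hG
    have : α = α' := by nlinarith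
    exact Or.inl (by rw [this])
  case A11.A11 α α' =>
    have e1 := h.s12
    have e2 := h.b22
    simp [coeffs, eq_comm (a := (0 : ℝ))] at e1 e2
    subst e2
    simp at e1 D1
    have : α = α' := by
      apply mul_left_cancel₀ (mul_ne_zero D1.1 D1.2)
      linear_combination e1
    exact Or.inl (by rw [this])
  case A12.A11 α =>
    have e1 := h.s22
    have e2 := h.b22
    simp [coeffs, eq_comm (a := (0 : ℝ))] at e1 e2
    subst e2
    simp at e1 D1
    tauto
  case A12.A12 => exact Or.inl rfl
  case A13.A13 α α' =>
    have e3 := h.det_s rfl ⟨rfl, rfl, rfl⟩ ⟨rfl, rfl⟩ (by simp [coeffs])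
    simp [coeffs] at e3
    exact Or.inl (by rw [e3])
  case A14.A13 α =>
    have e1 := h'.s11
    simp [coeffs] at e1
    exact absurd e1 h'.det_ne
  case A14.A14 => exact Or.inl rfl
  case A15.A10 α α' =>
    have e1 := h.disc_mul_det rfl ⟨rfl, rfl, rfl⟩
    have e2 := h.s12
    simp only [coeffs, disc] at e1 e2
    have hα : 1 ≤ α := hF
    -- The invariant reads `α ^ 2 - 1 ≥ 0` on one side and `-4 * (α' - 1 / 2) ^ 2 ≤ 0` on the other,
    -- so both vanish. Then `s = 0` in the target, while `s12 ≠ 0` in the source.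
    have : α' = 1 / 2 := by nlinarith [sq_nonneg (α' - 1 / 2)]
    subst this
    exact absurd (by linarith) D1
  case A15.A15 α α' =>
    have e1 := h.disc_mul_det rfl ⟨rfl, rfl, rfl⟩
    simp only [coeffs, disc] at e1
    have hα : 1 ≤ α := hF
    have hα' : 1 ≤ α' := hG
    have : α = α' := by nlinarith
    exact Or.inl (by rw [this])
  -- In the remaining pairs `det b` has different signs, or vanishes on one side only.
  all_goals
    exfalso
    have : 0 < κ ^ 2 := by positivity
    have : 0 < (p11 * p22 - p21 * p12) ^ 2 := by positivity
    first | exact hκ d1 | exact D1 d1 | linarith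

theorem equivalent_of_algebraIso {F G : Family} (hF : F.InRange) (hG : G.InRange)
    (h : AlgebraIso F.product G.product) : F.Equivalent G := by
  rw [product_eq, product_eq] at h
  obtain ⟨_, _, _, _, _, _, _, _, _, k⟩ := exists_isIntertwiner h
  obtain ⟨_, _, _, _, _, _, _, _, _, k'⟩ := exists_isIntertwiner h.symm
  rcases le_total G.index F.index with hle | hle
  · exact equivalent_of_isIntertwiner_of_index_le hF hG hle k k'
  · exact (equivalent_of_isIntertwiner_of_index_le hG hF hle k' k).symm

theorem algebraIso_of_equivalent {F G : Family} (h : F.Equivalent G) :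
    AlgebraIso F.product G.product := by
  rcases h with rfl | ⟨α, hα, ⟨rfl, rfl⟩ | ⟨rfl, rfl⟩⟩
  · exact AlgebraIso.refl _
  · rw [product_eq, product_eq]
    exact (algebraIso_A6_A7 hα).symm
  · rw [product_eq, product_eq]
    exact algebraIso_A6_A7 hα

end Family

theorem exists_algebraIso {μ : N3R →ₗ[ℝ] N3R →ₗ[ℝ] N3R} (h : IsCompleteLRStructure ℝ N3R μ) :
    ∃ F : Family, F.InRange ∧ (∀ α : ℝ, F = .A7 α → α ≤ -1 / 4) ∧ AlgebraIso μ F.product := by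
  obtain ⟨A, hA, hiso⟩ := exists_coeffs h
  obtain ⟨F, h1, h2, h3⟩ :=
    Coeffs.isClassified (Coeffs.isLR_of_isLRAlgebra (hiso.isLRAlgebra h.toIsLRAlgebra)) hA
  rw [← F.product_eq] at h3
  exact ⟨F, h1, h2, hiso.trans h3⟩

end N3R

theorem mainTheorem11 :
    -- every member of the list is a complete LR-structure on `𝔫₃(ℝ) ⊕ ℝ`
    (∀ F : N3R.Family, F.InRange → IsCompleteLRStructure ℝ N3R F.product) ∧
    -- every complete LR-structure on `𝔫₃(ℝ) ⊕ ℝ` is isomorphic to a member of the list, and to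
    -- exactly one after the range of the seventh family is restricted to `α ≤ -1/4`
    (∀ μ : N3R →ₗ[ℝ] N3R →ₗ[ℝ] N3R, IsCompleteLRStructure ℝ N3R μ →
      ∃! F : N3R.Family, F.InRange ∧ (∀ α : ℝ, F = .A7 α → α ≤ -1 / 4) ∧
        AlgebraIso μ F.product) ∧
    -- members of the list are isomorphic only if they are equal, apart from `A₇(α) ≃ A₆(-α)`
    -- for `α > -1/4`
    (∀ F G : N3R.Family, F.InRange → G.InRange →
      (AlgebraIso F.product G.product ↔
        F = G ∨ ∃ α : ℝ, -1 / 4 < α ∧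
          ((F = .A7 α ∧ G = .A6 (-α)) ∨ (F = .A6 (-α) ∧ G = .A7 α)))) := by
  refine ⟨fun F _ => F.isCompleteLRStructure, fun μ hμ => ?_, fun F G hF hG =>
    ⟨N3R.Family.equivalent_of_algebraIso hF hG, N3R.Family.algebraIso_of_equivalent⟩⟩
  obtain ⟨F, h1, h2, h3⟩ := N3R.exists_algebraIso hμ
  refine ⟨F, ⟨h1, h2, h3⟩, ?_⟩
  rintro G ⟨k1, k2, k3⟩
  rcases N3R.Family.equivalent_of_algebraIso k1 h1 (k3.symm.trans h3) with
    h | ⟨α, hα, ⟨hG, -⟩ | ⟨-, hF⟩⟩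
  · exact h
  · exact absurd (k2 α hG) hα.not_ge
  · exact absurd (h2 α hF) hα.not_ge
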